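/- **Theorem.** Let $n\ge 0$ be an integer, $\hbar>0$, $\varkappa\in\mathbb R$. Write $\hat z=(\hat p,x)$, $\hat p=-i\hbar\partial_x$, $x\in\mathbb R^n$, and $J=\begin{pmatrix}0&-\mathbb I\\ \mathbb I&0\end{pmatrix}$. Let $\mathcal H_{zz},W_{zz},W_{zw},W_{ww}$ be continuous functions of $t\in\mathbb R$ with values in the real $2n\times2n$ matrices, $\mathcal H_{zz},W_{zz},W_{ww}$ symmetric, and let $\mathcal H_z:\mathbb R\to\mathbb R^{2n}$ be continuous; they are the coefficients of the nonlocal Gross–Pitaevskii equation $\{-i\hbar\partial_t+\mathcal H(\hat z,t)+\varkappa\int\Psi^*(y,t)V(\hat z,\hat w,t)\Psi(y,t)\,dy\}\Psi=0$ (with $\hat w=(-i\hbar\partial_y,y)$), where $\mathcal H(\hat z,t)=\frac12\langle\hat z,\mathcal H_{zz}\hat z\rangle+\langle\mathcal H_z,\hat z\rangle$ and $V(\hat z,\hat w,t)=\frac12\langle\hat z,W_{zz}\hat z\rangle+\langle\hat z,W_{zw}\hat w\rangle+\frac12\langle\hat w,W_{ww}\hat w\rangle$. *Moments and trajectories.*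 $\mathcal P_\hbar^0$ is the class of functions $\psi(x)=\exp\{\frac i\hbar(S_0+\langle P_0,x-X_0\rangle)\}\,\varphi_0\big((x-X_0)/\sqrt\hbar\big)$ with $S_0\in\mathbb R$, $P_0,X_0\in\mathbb R^n$, $\varphi_0\in\mathcal S(\mathbb R^n)$. For such $\psi$ let $\langle\hat A\rangle_\psi=\langle\psi|\hat A|\psi\rangle/\|\psi\|^2$ (taken to be $0$ for $\psi=0$), $\tilde\varkappa=\varkappa\|\psi\|^2$ with the $L_2$ norm, and $\mathfrak g_0(\psi)=(z_\psi,\Delta_\psi)$, where $z_\psi=\langle\hat z\rangle_\psi$ and $(\Delta_\psi)_{jk}=\frac12\langle\Delta\hat z_j\Delta\hat z_k+\Delta\hat z_k\Delta\hat z_j\rangle_\psi$, $\Delta\hat z=\hat z-z_\psi$. Put $\mathfrak H_{zz}=\mathcal H_{zz}+\tilde\varkappa W_{zz}$. If $\psi$ is given at time $s$, let $\mathfrak g(t)=(z(t),\Delta(t))$, $z=(P,X)$, be the solution, with $\mathfrak g(s)=\mathfrak g_0(\psi)$, of the Hamilton–Ehrenfest system $$\dot z=J\{\mathcal H_z+[\mathcal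 H_{zz}+\tilde\varkappa(W_{zz}+W_{zw})]z\},\qquad \dot\Delta=J\mathfrak H_{zz}\Delta-\Delta\mathfrak H_{zz}J .$$ *Green function.* Let $\mathcal A(t,s)=\begin{pmatrix}\lambda_4^\top&-\lambda_2^\top\\-\lambda_3^\top&\lambda_1^\top\end{pmatrix}(t,s)$ be the solution of $\partial_t\mathcal A=J\mathfrak H_{zz}(t)\mathcal A$, $\mathcal A(s,s)=\mathbb I$, and let $S(t)=\int_0^t\{\langle P,\dot X\rangle-\mathfrak H\}\,d\tau$ with $\mathfrak H=\frac12\langle z,[\mathcal H_{zz}+\tilde\varkappa(W_{zz}+2W_{zw}+W_{ww})]z\rangle+\langle\mathcal H_z,z\rangle+\frac12\tilde\varkappa\,\mathrm{tr}(W_{ww}\Delta)$. For $\det\lambda_3(t,s)\ne0$, with $\Delta x=x-X(t)$, $\Delta y=y-X(s)$ and $\lambda_k=\lambda_k(t,s)$, put $$G_\varkappa(x,y,t,s,\mathfrak g(t),\mathfrak g(s))=\frac{1}{\sqrt{\det(-i2\pi\hbar\lambda_3)}}\exp\Big\{\frac i\hbar\Big[S(t)-S(s)+\langle P(t),\Delta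 x\rangle-\langle P(s),\Delta y\rangle-\tfrac12\langle\Delta y,\lambda_1\lambda_3^{-1}\Delta y\rangle+\langle\Delta x,\lambda_3^{-1}\Delta y\rangle-\tfrac12\langle\Delta x,\lambda_3^{-1}\lambda_4\Delta x\rangle\Big]\Big\}.$$ The branch of the root is the one for which $G_\varkappa\to\delta(x-y)$ as $t\to s$, continued in $t$: it is $\lim_{\varepsilon\to0+}R_\varepsilon(t,s)$, where $R_\varepsilon(\cdot,s)$ is the continuous square root of the nowhere vanishing function $t\mapsto\det\{-i2\pi\hbar(\lambda_3+i\varepsilon(\lambda_1+\lambda_4)-\varepsilon^2\lambda_2)(t,s)\}$ that is positive at $t=s$. *Evolution operators.* For $\psi$ given at time $s$, with $\tilde\varkappa$ and $\mathfrak g$ determined by $\psi$ as above ($\mathfrak g(s)=\mathfrak g_0(\psi)$), let $$\hat U_\varkappa(t,s,\psi)(x)=\int_{\mathbb R^n}G_\varkappa(x,y,t,s,\mathfrak g(t),\mathfrak g(s))\,\psi(y)\,dy .$$ For $\phi$ given at time $t$, with $\tilde\varkappa=\varkappa\|\phi\|^2$ and $\mathfrak g$ determined by $\mathfrak g(t)=\mathfrak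 g_0(\phi)$, let $$\hat U_\varkappa^{-1}(t,s,\phi)(x)=\int_{\mathbb R^n}G_\varkappa(x,y,s,t,\mathfrak g(s),\mathfrak g(t))\,\phi(y)\,dy .$$ For $t=s$ the kernel is $\delta(x-y)$, so both operators are the identity. *Claim.* $\hat U_\varkappa^{-1}(t,s,\cdot)$ is a left inverse of $\hat U_\varkappa(t,s,\cdot)$: for every $\psi\in\mathcal P_\hbar^0$ and all $t,s\in\mathbb R$ such that $t=s$ or $\det\lambda_3(t,s)\neq0$ (with $\lambda_3$ formed with $\tilde\varkappa=\varkappa\|\psi\|^2$), $$\hat U_\varkappa^{-1}\big(t,s,\hat U_\varkappa(t,s,\psi)\big)(x)=\psi(x)\qquad\text{for all }x\in\mathbb R^n .$$ -/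

import Mathlib

open MeasureTheory Filter Topology Matrix

namespace NonlocalGPE

noncomputable section

/-- Vectors and matrices on the phase space `ℝ^{2n}`; the coordinates are ordered as
`z = (p, x)`, so that `Sum.inl j` is the momentum `p_j` and `Sum.inr j` the position `x_j`. -/
abbrev PhaseVec (n : ℕ) : Type := Fin n ⊕ Fin n → ℝ

abbrev PhaseMat (n : ℕ) : Type := Matrix (Fin n ⊕ Fin n) (Fin n ⊕ Fin n) ℝ

/-- The coefficients of the two quadratic operators
`H(ẑ, t) = ½⟨ẑ, H_zz(t) ẑ⟩ + ⟨H_z(t), ẑ⟩` and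
`V(ẑ, ŵ, t) = ½⟨ẑ, W_zz(t) ẑ⟩ + ⟨ẑ, W_zw(t) ŵ⟩ + ½⟨ŵ, W_ww(t) ŵ⟩`:
real, continuous in time, with the symmetry that makes both operators self-adjoint. -/
structure Coeffs (n : ℕ) where
  Hzz : ℝ → PhaseMat n
  Hz : ℝ → PhaseVec n
  Wzz : ℝ → PhaseMat n
  Wzw : ℝ → PhaseMat n
  Www : ℝ → PhaseMat n
  continuous_Hzz : Continuous Hzz
  continuous_Hz : Continuous Hz
  continuous_Wzz : Continuous Wzz
  continuous_Wzw : Continuous Wzw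
  continuous_Www : Continuous Www
  isSymm_Hzz : ∀ t, (Hzz t).IsSymm
  isSymm_Wzz : ∀ t, (Wzz t).IsSymm
  isSymm_Www : ∀ t, (Www t).IsSymm

variable {n : ℕ}

/-! ### Trajectory concentrated functions and their moments -/

/-- The class of trajectory concentrated functions at a fixed time, for a fixed `ħ`:
`ψ(x) = exp{(i/ħ)(S₀ + ⟨P₀, x - X₀⟩)} φ₀((x - X₀)/√ħ)` with `φ₀` a Schwartz function. -/
def tcfClass (n : ℕ) (ħ : ℝ) : Set (EuclideanSpace ℝ (Fin n) → ℂ) :=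
  {ψ | ∃ (S₀ : ℝ) (P₀ X₀ : EuclideanSpace ℝ (Fin n))
      (φ₀ : SchwartzMap (EuclideanSpace ℝ (Fin n)) ℂ),
      ∀ x, ψ x = Complex.exp (Complex.I / ħ * ((S₀ + inner ℝ P₀ (x - X₀) : ℝ) : ℂ)) *
        φ₀ ((Real.sqrt ħ)⁻¹ • (x - X₀))}

/-- `‖ψ‖²`, the squared norm in `L²(ℝⁿ)`. -/
def normSq (ψ : EuclideanSpace ℝ (Fin n) → ℂ) : ℝ := ∫ x, ‖ψ x‖ ^ 2

/-- The operators `ẑ = (p̂, x)`, `p̂_j = -iħ ∂/∂x_j`. -/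
def zOp (ħ : ℝ) : Fin n ⊕ Fin n → (EuclideanSpace ℝ (Fin n) → ℂ) →
    EuclideanSpace ℝ (Fin n) → ℂ
  | Sum.inl j, ψ => fun x => -Complex.I * ħ * fderiv ℝ ψ x (EuclideanSpace.single j 1)
  | Sum.inr j, ψ => fun x => (x j : ℂ) * ψ x

/-- The mean value `⟨Â⟩ = ⟨ψ|Â|ψ⟩ / ‖ψ‖²`. It is applied to symmetric operators only, whose
mean values are real, and is therefore taken as a real number. -/
def mean (A : (EuclideanSpace ℝ (Fin n) → ℂ) → EuclideanSpace ℝ (Fin n) → ℂ)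
    (ψ : EuclideanSpace ℝ (Fin n) → ℂ) : ℝ :=
  (∫ x, star (ψ x) * A ψ x).re / normSq ψ

/-- The first moments `z_ψ = (⟨p̂⟩, ⟨x⟩)`. -/
def zMean (ħ : ℝ) (ψ : EuclideanSpace ℝ (Fin n) → ℂ) : PhaseVec n :=
  fun k => mean (zOp ħ k) ψ

/-- The centred operators `Δẑ_k = ẑ_k - z_k`. -/
def dzOp (ħ : ℝ) (z : PhaseVec n) (k : Fin n ⊕ Fin n)
    (ψ : EuclideanSpace ℝ (Fin n) → ℂ) : EuclideanSpace ℝ (Fin n) → ℂ :=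
  fun x => zOp ħ k ψ x - (z k : ℂ) * ψ x

/-- The second centred moments `½⟨Δẑ_j Δẑ_k + Δẑ_k Δẑ_j⟩`. -/
def covMean (ħ : ℝ) (ψ : EuclideanSpace ℝ (Fin n) → ℂ) : PhaseMat n :=
  Matrix.of fun j k => 1 / 2 * mean (fun φ x =>
    dzOp ħ (zMean ħ ψ) j (dzOp ħ (zMean ħ ψ) k φ) x +
    dzOp ħ (zMean ħ ψ) k (dzOp ħ (zMean ħ ψ) j φ) x) ψ

/-- The moments `𝔤₀(ψ) = ⟨ψ|ĝ|ψ⟩ / ‖ψ‖²` of first and second order. -/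
def moments (ħ : ℝ) (ψ : EuclideanSpace ℝ (Fin n) → ℂ) : PhaseVec n × PhaseMat n :=
  (zMean ħ ψ, covMean ħ ψ)

/-! ### The Hamilton–Ehrenfest system and the system in variations

Below `κt` stands for the parameter `ϰ‖ψ‖²`. -/

/-- `𝔥_zz(t) = H_zz(t) + κt W_zz(t)`. -/
def Coeffs.hzz (D : Coeffs n) (κt t : ℝ) : PhaseMat n := D.Hzz t + κt • D.Wzz t

/-- `g = (z, Δ)` solves the Hamilton–Ehrenfest system
`ż = J{H_z + [H_zz + κt(W_zz + W_zw)]z}`, `Δ̇ = J 𝔥_zz Δ - Δ 𝔥_zz J` on the whole time axis. -/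
def IsHESSolution (D : Coeffs n) (κt : ℝ) (g : ℝ → PhaseVec n × PhaseMat n) : Prop :=
  (∀ t k, HasDerivAt (fun τ => (g τ).1 k)
    ((Matrix.J (Fin n) ℝ *ᵥ
      (D.Hz t + (D.Hzz t + κt • (D.Wzz t + D.Wzw t)) *ᵥ (g t).1)) k) t) ∧
  (∀ t j k, HasDerivAt (fun τ => (g τ).2 j k)
    ((Matrix.J (Fin n) ℝ * D.hzz κt t * (g t).2 -
      (g t).2 * D.hzz κt t * Matrix.J (Fin n) ℝ) j k) t)

/-- The solution of the Hamilton–Ehrenfest system (a linear system) with `g(s) = g₀`. -/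
def hesSolution (D : Coeffs n) (κt s : ℝ) (g₀ : PhaseVec n × PhaseMat n) :
    ℝ → PhaseVec n × PhaseMat n :=
  Classical.epsilon fun g => IsHESSolution D κt g ∧ g s = g₀

/-- The solution `𝒜(·, s)` of the system in variations `𝒜̇ = J 𝔥_zz 𝒜`, `𝒜(s, s) = 1`. -/
def matricant (D : Coeffs n) (κt t s : ℝ) : PhaseMat n :=
  (Classical.epsilon fun A : ℝ → PhaseMat n =>
    (∀ τ j k, HasDerivAt (fun σ => A σ j k)
      ((Matrix.J (Fin n) ℝ * D.hzz κt τ * A τ) j k) τ) ∧ A s = 1) t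

/-! The blocks of `𝒜(t, s) = [[λ₄ᵀ, -λ₂ᵀ], [-λ₃ᵀ, λ₁ᵀ]]`. -/

def lam1 (D : Coeffs n) (κt t s : ℝ) : Matrix (Fin n) (Fin n) ℝ :=
  (matricant D κt t s).toBlocks₂₂ᵀ

def lam2 (D : Coeffs n) (κt t s : ℝ) : Matrix (Fin n) (Fin n) ℝ :=
  -(matricant D κt t s).toBlocks₁₂ᵀ

def lam3 (D : Coeffs n) (κt t s : ℝ) : Matrix (Fin n) (Fin n) ℝ :=
  -(matricant D κt t s).toBlocks₂₁ᵀ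

def lam4 (D : Coeffs n) (κt t s : ℝ) : Matrix (Fin n) (Fin n) ℝ :=
  (matricant D κt t s).toBlocks₁₁ᵀ

/-! ### The Green function -/

/-- The scalar part of the Hamiltonian of the linear associated Schrödinger equation,
`𝔥 = ½⟨z, [H_zz + κt(W_zz + 2W_zw + W_ww)]z⟩ + ⟨H_z, z⟩ + ½ κt tr(W_ww Δ)`. -/
def scalarHam (D : Coeffs n) (κt t : ℝ) (g : PhaseVec n × PhaseMat n) : ℝ :=
  1 / 2 * (g.1 ⬝ᵥ ((D.Hzz t + κt • (D.Wzz t + (2 : ℝ) • D.Wzw t + D.Www t)) *ᵥ g.1)) +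
    D.Hz t ⬝ᵥ g.1 + 1 / 2 * κt * (D.Www t * g.2).trace

/-- The action `S(t) = ∫₀ᵗ {⟨P, Ẋ⟩ - 𝔥} dτ` along a trajectory `g = ((P, X), Δ)`. -/
def action (D : Coeffs n) (κt : ℝ) (g : ℝ → PhaseVec n × PhaseMat n) (t : ℝ) : ℝ :=
  ∫ τ in (0 : ℝ)..t,
    (∑ j, (g τ).1 (Sum.inl j) * deriv (fun σ => (g σ).1 (Sum.inr j)) τ -
      scalarHam D κt τ (g τ))

/-- The square root of a nowhere vanishing `C¹` function `f`, continued along the time axis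
from its principal value at `s`. -/
def sqrtAlong (f : ℝ → ℂ) (s t : ℝ) : ℂ :=
  f s ^ (1 / 2 : ℂ) * Complex.exp (1 / 2 * ∫ τ in s..t, logDeriv f τ)

/-- `det(-i2πħ(λ₃ + iε(λ₁ + λ₄) - ε²λ₂)(t, s))`, the regularization of `det(-i2πħλ₃(t, s))`
that arises when the Green function of the equation with the quadratic Hamiltonian
`½⟨ẑ, 𝔥_zz ẑ⟩` is smeared in `x` and in `y` with the Gaussian approximation
`(2πħε)^{-n/2} exp(-|x|²/(2ħε))` of the delta function. For `ε > 0` it has no zeros, and for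
`t = s` it is equal to `(4πħε)ⁿ > 0`. -/
def regDet (D : Coeffs n) (ħ κt ε t s : ℝ) : ℂ :=
  ((-Complex.I * 2 * Real.pi * ħ) •
    ((lam3 D κt t s).map Complex.ofReal +
      (Complex.I * ε) • (lam1 D κt t s + lam4 D κt t s).map Complex.ofReal -
      ((ε : ℂ) ^ 2) • (lam2 D κt t s).map Complex.ofReal)).det

/-- The branch of `√det(-i2πħλ₃(t, s))` that belongs to the Green function, that is, to the
kernel which tends to `δ(x - y)` as `t → s`: the regularized determinant is continued in time
from its positive value at `t = s`, and the regularization is removed. -/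
def sqrtDet (D : Coeffs n) (ħ κt t s : ℝ) : ℂ :=
  limUnder (𝓝[>] (0 : ℝ)) fun ε : ℝ => sqrtAlong (fun τ => regDet D ħ κt ε τ s) s t

/-- The real phase of the Green function, with `Δx = x - X(t)` and `Δy = y - X(s)`. -/
def greenPhase (D : Coeffs n) (κt : ℝ) (g : ℝ → PhaseVec n × PhaseMat n) (t s : ℝ)
    (x y : EuclideanSpace ℝ (Fin n)) : ℝ :=
  let P : ℝ → Fin n → ℝ := fun τ j => (g τ).1 (Sum.inl j)
  let X : ℝ → Fin n → ℝ := fun τ j => (g τ).1 (Sum.inr j)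
  let Δx : Fin n → ℝ := fun j => x j - X t j
  let Δy : Fin n → ℝ := fun j => y j - X s j
  action D κt g t - action D κt g s + P t ⬝ᵥ Δx - P s ⬝ᵥ Δy
    - 1 / 2 * (Δy ⬝ᵥ ((lam1 D κt t s * (lam3 D κt t s)⁻¹) *ᵥ Δy))
    + Δx ⬝ᵥ ((lam3 D κt t s)⁻¹ *ᵥ Δy)
    - 1 / 2 * (Δx ⬝ᵥ (((lam3 D κt t s)⁻¹ * lam4 D κt t s) *ᵥ Δx))

/-- The Green function `G(x, y, t, s, g(t), g(s))` of the linear associated Schrödinger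
equation along the trajectory `g`, for `det λ₃(t, s) ≠ 0`. -/
def green (D : Coeffs n) (ħ κt : ℝ) (g : ℝ → PhaseVec n × PhaseMat n) (t s : ℝ)
    (x y : EuclideanSpace ℝ (Fin n)) : ℂ :=
  1 / sqrtDet D ħ κt t s * Complex.exp (Complex.I / ħ * (greenPhase D κt g t s x y : ℂ))

/-! ### The nonlinear evolution operator and its left inverse -/

/-- The trajectory `g(·, ℭ(ψ))` for a function `ψ` given at the time `s`: the solution of the
Hamilton–Ehrenfest system whose value at `s` is the moments of `ψ`, with `κt = ϰ‖ψ‖²`. -/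
def trajectory (D : Coeffs n) (ħ κ s : ℝ) (ψ : EuclideanSpace ℝ (Fin n) → ℂ) :
    ℝ → PhaseVec n × PhaseMat n :=
  hesSolution D (κ * normSq ψ) s (moments ħ ψ)

open Classical in
/-- The evolution operator `Û(t, s, ψ)`, where `ψ` is given at the time `s`. For `t = s` the
kernel is the delta function. -/
def evolution (D : Coeffs n) (ħ κ t s : ℝ) (ψ : EuclideanSpace ℝ (Fin n) → ℂ) :
    EuclideanSpace ℝ (Fin n) → ℂ :=
  fun x => if t = s then ψ x else
    ∫ y, green D ħ (κ * normSq ψ) (trajectory D ħ κ s ψ) t s x y * ψ y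

open Classical in
/-- The operator `Û⁻¹(t, s, φ)`, where `φ` is given at the time `t`: the integral operator
with the Green function in which the times are interchanged. -/
def evolutionInv (D : Coeffs n) (ħ κ t s : ℝ) (φ : EuclideanSpace ℝ (Fin n) → ℂ) :
    EuclideanSpace ℝ (Fin n) → ℂ :=
  fun x => if t = s then φ x else
    ∫ y, green D ħ (κ * normSq φ) (trajectory D ħ κ t φ) s t x y * φ y

end

end NonlocalGPE

/-!
For `t ≠ s` the linear operator with kernel `G(·, ·, t, s, g(t), g(s))` is a multiplication by a
quadratic phase, followed by a Fourier transform in the variable `λ₃⁻¹`, followed by another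
quadratic phase. Each factor is isometric on `L²` and intertwines the centred operators `ẑ - z`
with a symplectic matrix, and the product of the three matrices is the matricant `𝒜(t, s)`. Hence
`Û(t, s, ψ)` has the norm of `ψ`, first moments `z(t)` and second moments `𝒜 Δ(s) 𝒜ᵀ = Δ(t)`:
the function `Û(t, s, ψ)` given at time `t` determines the same parameter `ϰ‖ψ‖²` and the same
trajectory as `ψ` given at time `s`. Both integral operators are therefore built from one
trajectory, and it remains to invert a linear isometry. Interchanging the times changes the sign
of the phase (as `𝒜` is symplectic) and conjugates the continued square root, so that the kernel
of `Û⁻¹` is that of the adjoint.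
-/

namespace NonlocalGPE

/-! ### Linear differential equations -/

section LinearODE

variable {E : Type*} [NormedAddCommGroup E] [NormedSpace ℝ E]

/-- The terms of the Dyson series of the linear equation `u' = A u + b`, `u(s) = x₀`: the sum of
the first `k` of them is the `k`-th Picard iterate. -/
noncomputable def dysonTerm (A : ℝ → E →L[ℝ] E) (b : ℝ → E) (s : ℝ) (x₀ : E) : ℕ → ℝ → E
  | 0 => fun t => x₀ + ∫ τ in s..t, b τ
  | k + 1 => fun t => ∫ τ in s..t, A τ (dysonTerm A b s x₀ k τ)

variable {A : ℝ → E →L[ℝ] E} {b : ℝ → E} {s : ℝ} {x₀ : E}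

lemma hasDerivAt_dysonTerm_zero [CompleteSpace E] (hb : Continuous b) (t : ℝ) :
    HasDerivAt (dysonTerm A b s x₀ 0) (b t) t :=
  (hb.integral_hasStrictDerivAt s t).hasDerivAt.const_add x₀

lemma continuous_dysonTerm [CompleteSpace E] (hA : Continuous A) (hb : Continuous b) (k : ℕ) :
    Continuous (dysonTerm A b s x₀ k) := by
  induction k with
  | zero =>
    exact continuous_iff_continuousAt.2 fun t => (hasDerivAt_dysonTerm_zero hb t).continuousAt
  | succ k ih =>
    exact continuous_iff_continuousAt.2 fun t =>
      ((hA.clm_apply ih).integral_hasStrictDerivAt s t).hasDerivAt.continuousAt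

lemma hasDerivAt_dysonTerm_succ [CompleteSpace E] (hA : Continuous A) (hb : Continuous b)
    (k : ℕ) (t : ℝ) :
    HasDerivAt (dysonTerm A b s x₀ (k + 1)) (A t (dysonTerm A b s x₀ k t)) t :=
  ((hA.clm_apply (continuous_dysonTerm hA hb k)).integral_hasStrictDerivAt s t).hasDerivAt

lemma norm_dysonTerm_le {T C K : ℝ} (hAK : ∀ t ∈ Metric.ball s T, ‖A t‖ ≤ K)
    (h0 : ∀ t ∈ Metric.ball s T, ‖dysonTerm A b s x₀ 0 t‖ ≤ C) (k : ℕ) :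
    ∀ t ∈ Metric.ball s T, ‖dysonTerm A b s x₀ k t‖ ≤ (K * |t - s|) ^ k / k.factorial * C := by
  induction k with
  | zero => simpa using h0
  | succ k ih =>
    intro t ht
    have hs : s ∈ Metric.ball s T := Metric.mem_ball_self (dist_nonneg.trans_lt ht)
    have hsub : Set.uIoc s t ⊆ Metric.ball s T :=
      Set.uIoc_subset_uIcc.trans ((convex_ball s T).ordConnected.uIcc_subset hs ht)
    calc ‖dysonTerm A b s x₀ (k + 1) t‖
        = ‖∫ τ in Set.uIoc s t, A τ (dysonTerm A b s x₀ k τ)‖ := by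
          rw [dysonTerm, intervalIntegral.norm_intervalIntegral_eq]
      _ ≤ ∫ τ in Set.uIoc s t, K ^ (k + 1) * |τ - s| ^ k / k.factorial * C := by
          refine norm_integral_le_of_norm_le (Continuous.integrableOn_uIoc (by fun_prop)) ?_
          refine (ae_restrict_mem measurableSet_uIoc).mono fun τ hτ => ?_
          calc ‖A τ (dysonTerm A b s x₀ k τ)‖
              ≤ K * ((K * |τ - s|) ^ k / k.factorial * C) :=
                (A τ).le_of_opNorm_le_of_le (hAK τ (hsub hτ)) (ih τ (hsub hτ))
            _ = _ := by rw [mul_pow]; ring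
      _ = K ^ (k + 1) * (|t - s| ^ (k + 1) / (k + 1)) / k.factorial * C := by
          rw [integral_mul_const, integral_div, integral_const_mul, integral_pow_abs_sub_uIoc]
      _ = (K * |t - s|) ^ (k + 1) / (k + 1).factorial * C := by
          rw [Nat.factorial_succ]
          push_cast
          field_simp
          ring

lemma exists_norm_dysonTerm_le [CompleteSpace E] (hA : Continuous A) (hb : Continuous b)
    (s : ℝ) (x₀ : E) {T : ℝ} (hT : 0 ≤ T) :
    ∃ K C : ℝ, ∀ t ∈ Metric.ball s T, ‖A t‖ ≤ K ∧
      ∀ k : ℕ, ‖dysonTerm A b s x₀ k t‖ ≤ (K * T) ^ k / k.factorial * C := by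
  obtain ⟨K, hK⟩ := (isCompact_closedBall s T).exists_bound_of_continuousOn hA.continuousOn
  obtain ⟨C, hC⟩ := (isCompact_closedBall s T).exists_bound_of_continuousOn
    (continuous_dysonTerm (x₀ := x₀) (s := s) hA hb 0).continuousOn
  have hs : s ∈ Metric.closedBall s T := Metric.mem_closedBall_self hT
  have hK₀ : 0 ≤ K := (norm_nonneg _).trans (hK s hs)
  have hC₀ : 0 ≤ C := (norm_nonneg _).trans (hC s hs)
  refine ⟨K, C, fun t ht => ⟨hK t (Metric.ball_subset_closedBall ht), fun k => ?_⟩⟩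
  refine (norm_dysonTerm_le (fun t ht => hK t (Metric.ball_subset_closedBall ht))
    (fun t ht => hC t (Metric.ball_subset_closedBall ht)) k t ht).trans ?_
  have hts : |t - s| ≤ T := (Metric.mem_ball.1 ht).le
  gcongr

lemma summable_dysonTerm [CompleteSpace E] (hA : Continuous A) (hb : Continuous b) (t : ℝ) :
    Summable fun k => dysonTerm A b s x₀ k t := by
  obtain ⟨K, C, h⟩ := exists_norm_dysonTerm_le hA hb s x₀ (T := |t - s| + 1) (by positivity)
  exact Summable.of_norm_bounded ((Real.summable_pow_div_factorial _).mul_right C)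
    (h t (by simp [Real.dist_eq])).2

lemma hasDerivAt_tsum_dysonTerm_succ [CompleteSpace E] (hA : Continuous A) (hb : Continuous b)
    (t : ℝ) : HasDerivAt (fun t => ∑' k, dysonTerm A b s x₀ (k + 1) t)
      (∑' k, A t (dysonTerm A b s x₀ k t)) t := by
  have hT : 0 < |t - s| + 1 := by positivity
  obtain ⟨K, C, h⟩ := exists_norm_dysonTerm_le hA hb s x₀ hT.le
  exact hasDerivAt_tsum_of_isPreconnected
    (((Real.summable_pow_div_factorial _).mul_right C).mul_left K) Metric.isOpen_ball
    (convex_ball s _).isPreconnected (fun k τ _ => hasDerivAt_dysonTerm_succ hA hb k τ)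
    (fun k τ hτ => (A τ).le_of_opNorm_le_of_le (h τ hτ).1 ((h τ hτ).2 k))
    (Metric.mem_ball_self hT) ((summable_nat_add_iff 1).2 (summable_dysonTerm hA hb s))
    (by simp [Real.dist_eq])

theorem exists_linearODE_solution [CompleteSpace E] (hA : Continuous A) (hb : Continuous b)
    (s : ℝ) (x₀ : E) :
    ∃ u : ℝ → E, (∀ t, HasDerivAt u (A t (u t) + b t) t) ∧ u s = x₀ := by
  refine ⟨fun t => dysonTerm A b s x₀ 0 t + ∑' k, dysonTerm A b s x₀ (k + 1) t, fun t => ?_,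
    by simp [dysonTerm]⟩
  refine ((hasDerivAt_dysonTerm_zero hb t).add
    (hasDerivAt_tsum_dysonTerm_succ hA hb t)).congr_deriv ?_
  have hsum : Summable fun k => dysonTerm A b s x₀ k t := summable_dysonTerm hA hb t
  rw [← (A t).map_tsum hsum, hsum.tsum_eq_zero_add, add_comm]

theorem linearODE_solution_unique (hA : Continuous A) {u v : ℝ → E}
    (hu : ∀ t, HasDerivAt u (A t (u t) + b t) t) (hv : ∀ t, HasDerivAt v (A t (v t) + b t) t)
    (h : u s = v s) : u = v := by
  funext t
  set T := |t - s| + 1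
  obtain ⟨K, hK⟩ := (isCompact_closedBall s T).exists_bound_of_continuousOn hA.continuousOn
  have ht : t ∈ Set.Ioo (s - T) (s + T) := by
    rw [← Real.ball_eq_Ioo]; simp [Real.dist_eq, T]
  have hs : s ∈ Set.Ioo (s - T) (s + T) := by
    rw [← Real.ball_eq_Ioo]; exact Metric.mem_ball_self (by positivity)
  refine ODE_solution_unique_of_mem_Ioo (v := fun t x => A t x + b t) (s := fun _ => Set.univ)
    (K := K.toNNReal) (fun τ hτ => ?_) hs (fun τ _ => ⟨hu τ, trivial⟩)
    (fun τ _ => ⟨hv τ, trivial⟩) h ht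
  refine LipschitzWith.lipschitzOnWith (LipschitzWith.of_dist_le_mul fun x y => ?_)
  rw [← Real.ball_eq_Ioo] at hτ
  have hKτ := hK τ (Metric.ball_subset_closedBall hτ)
  rw [dist_add_right, dist_eq_norm, dist_eq_norm, ← map_sub,
    Real.coe_toNNReal _ ((norm_nonneg _).trans hKτ)]
  exact (A τ).le_of_opNorm_le hKτ _

end LinearODE

open scoped Matrix.Norms.Operator

lemma hasDerivAt_matrix_iff {ι 𝕜 : Type*} [Finite ι] [RCLike 𝕜] {A : ℝ → Matrix ι ι 𝕜}
    {A' : Matrix ι ι 𝕜} {t : ℝ} :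
    HasDerivAt A A' t ↔ ∀ j k, HasDerivAt (fun τ => A τ j k) (A' j k) t := by
  cases nonempty_fintype ι
  exact hasDerivAt_pi.trans (forall_congr' fun _ => hasDerivAt_pi)

lemma hasDerivAt_transpose {ι : Type*} [Finite ι] {A : ℝ → Matrix ι ι ℝ} {A' : Matrix ι ι ℝ}
    {t : ℝ} (h : HasDerivAt A A' t) : HasDerivAt (fun τ => (A τ)ᵀ) A'ᵀ t :=
  hasDerivAt_matrix_iff.2 fun j k => hasDerivAt_matrix_iff.1 h k j

section MatrixODE

variable {ι : Type*} [Fintype ι]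

lemma continuous_toContinuousLinearMap_mulVecLin {N : ℝ → Matrix ι ι ℝ}
    (hN : Continuous N) :
    Continuous fun t => (N t).mulVecLin.toContinuousLinearMap :=
  continuous_clm_apply.2 fun _ => hN.matrix_mulVec continuous_const

variable {N A B : ℝ → Matrix ι ι ℝ} {s : ℝ}

lemma exists_matrixODE_solution (hN : Continuous N) (s : ℝ) (A₀ : Matrix ι ι ℝ) :
    ∃ A, (∀ t, HasDerivAt A (N t * A t) t) ∧ A s = A₀ := by
  obtain ⟨A, hA, hAs⟩ := exists_linearODE_solution
    (A := fun t => ContinuousLinearMap.mul ℝ (Matrix ι ι ℝ) (N t)) (b := fun _ => 0)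
    (by fun_prop) continuous_const s A₀
  exact ⟨A, fun t => (hA t).congr_deriv (by simp), hAs⟩

lemma matrixODE_solution_unique (hN : Continuous N) (hA : ∀ t, HasDerivAt A (N t * A t) t)
    (hB : ∀ t, HasDerivAt B (N t * B t) t) (h : A s = B s) : A = B :=
  linearODE_solution_unique (A := fun t => ContinuousLinearMap.mul ℝ _ (N t)) (b := fun _ => 0)
    (by fun_prop) (fun t => (hA t).congr_deriv (by simp)) (fun t => (hB t).congr_deriv (by simp)) h

lemma transpose_mul_mul_eq_of_hasDerivAt {M : Matrix ι ι ℝ}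
    (hA : ∀ t, HasDerivAt A (N t * A t) t) (hM : ∀ t, (N t)ᵀ * M + M * N t = 0) (t s : ℝ) :
    (A t)ᵀ * M * A t = (A s)ᵀ * M * A s := by
  classical
  have hd (τ : ℝ) : HasDerivAt (fun τ => (A τ)ᵀ * M * A τ) 0 τ := by
    refine (((hasDerivAt_transpose (hA τ)).mul_const M).mul (hA τ)).congr_deriv ?_
    calc (N τ * A τ)ᵀ * M * A τ + (A τ)ᵀ * M * (N τ * A τ)
        = (A τ)ᵀ * ((N τ)ᵀ * M + M * N τ) * A τ := by rw [transpose_mul]; noncomm_ring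
      _ = 0 := by simp [hM]
  exact is_const_of_deriv_eq_zero (fun τ => (hd τ).differentiableAt) (fun τ => (hd τ).deriv) t s

lemma hasDerivAt_mul_mul_transpose {N : Matrix ι ι ℝ} {t : ℝ} (hA : HasDerivAt A (N * A t) t)
    (C : Matrix ι ι ℝ) : HasDerivAt (fun τ => A τ * C * (A τ)ᵀ)
      (N * (A t * C * (A t)ᵀ) + A t * C * (A t)ᵀ * Nᵀ) t := by
  classical
  refine ((hA.mul_const C).mul (hasDerivAt_transpose hA)).congr_deriv ?_
  rw [transpose_mul]
  noncomm_ring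

variable [DecidableEq ι]

lemma lyapunovODE_solution_eq {Δ : ℝ → Matrix ι ι ℝ} (hN : Continuous N)
    (hA : ∀ t, HasDerivAt A (N t * A t) t) (hAs : A s = 1)
    (hΔ : ∀ t, HasDerivAt Δ (N t * Δ t + Δ t * (N t)ᵀ) t) (t : ℝ) :
    Δ t = A t * Δ s * (A t)ᵀ := by
  let mul := ContinuousLinearMap.mul ℝ (Matrix ι ι ℝ)
  have hcont : Continuous fun t => mul (N t) + mul.flip (N t)ᵀ := by
    have := hN.matrix_transpose
    fun_prop
  exact congrFun (linearODE_solution_unique (b := fun _ => 0) (s := s) hcont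
    (fun t => (hΔ t).congr_deriv (by simp [mul]))
    (fun t => (hasDerivAt_mul_mul_transpose (hA t) (Δ s)).congr_deriv (by simp [mul]))
    (by simp [hAs])) t

lemma contDiff_det {m : WithTop ℕ∞} : ContDiff ℝ m fun M : Matrix ι ι ℂ => M.det := by
  simp_rw [det_apply]
  exact ContDiff.sum fun σ _ => (contDiff_prod fun i _ =>
    (entryLinearMap ℝ ℂ (σ i) i).toContinuousLinearMap.contDiff).const_smul _

end MatrixODE

/-! ### The matricant and the Hamilton–Ehrenfest flow -/

section Trajectories

variable {n : ℕ} (D : Coeffs n) (κt : ℝ)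

lemma continuous_hzz : Continuous (D.hzz κt) :=
  D.continuous_Hzz.add (D.continuous_Wzz.const_smul κt)

lemma isSymm_hzz (t : ℝ) : (D.hzz κt t).IsSymm :=
  (D.isSymm_Hzz t).add ((D.isSymm_Wzz t).smul κt)

/-- The matrix `J 𝔥_zz` of the system in variations. -/
def variationMatrix (t : ℝ) : PhaseMat n := J (Fin n) ℝ * D.hzz κt t

lemma continuous_variationMatrix : Continuous (variationMatrix D κt) :=
  continuous_const.matrix_mul (continuous_hzz D κt)

lemma variationMatrix_transpose (t : ℝ) :
    (variationMatrix D κt t)ᵀ = -(D.hzz κt t * J (Fin n) ℝ) := by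
  rw [variationMatrix, transpose_mul, (isSymm_hzz D κt t).eq, J_transpose, Matrix.mul_neg]

lemma matricant_spec (s : ℝ) :
    (∀ t, HasDerivAt (fun τ => matricant D κt τ s)
      (variationMatrix D κt t * matricant D κt t s) t) ∧ matricant D κt s s = 1 := by
  obtain ⟨A, hA, hAs⟩ := exists_matrixODE_solution (continuous_variationMatrix D κt) s 1
  obtain ⟨h, hs⟩ := Classical.epsilon_spec (p := fun A : ℝ → PhaseMat n =>
    (∀ τ j k, HasDerivAt (fun σ => A σ j k) ((J (Fin n) ℝ * D.hzz κt τ * A τ) j k) τ) ∧ A s = 1)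
    ⟨A, fun t => hasDerivAt_matrix_iff.1 (hA t), hAs⟩
  exact ⟨fun t => hasDerivAt_matrix_iff.2 (h t), hs⟩

lemma hasDerivAt_matricant (t s : ℝ) : HasDerivAt (fun τ => matricant D κt τ s)
    (variationMatrix D κt t * matricant D κt t s) t :=
  (matricant_spec D κt s).1 t

lemma matricant_self (s : ℝ) : matricant D κt s s = 1 := (matricant_spec D κt s).2

lemma matricant_mul (t r s : ℝ) :
    matricant D κt t r * matricant D κt r s = matricant D κt t s := by
  refine congrFun (matrixODE_solution_unique (s := r) (continuous_variationMatrix D κt)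
    (A := fun t => matricant D κt t r * matricant D κt r s) (fun t => ?_)
    (fun t => hasDerivAt_matricant D κt t s) (by simp [matricant_self])) t
  exact ((hasDerivAt_matricant D κt t r).mul_const _).congr_deriv (Matrix.mul_assoc _ _ _)

lemma matricant_mem_symplecticGroup (t s : ℝ) :
    matricant D κt t s ∈ symplecticGroup (Fin n) ℝ := by
  have hJ : J (Fin n) ℝ * J (Fin n) ℝ = -1 := J_squared (Fin n) ℝ
  refine SymplecticGroup.mem_iff'.2 ((transpose_mul_mul_eq_of_hasDerivAt
    (fun τ => hasDerivAt_matricant D κt τ s) (fun τ => ?_) t s).trans (by simp [matricant_self]))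
  rw [variationMatrix_transpose, variationMatrix, Matrix.neg_mul, Matrix.mul_assoc, hJ,
    ← Matrix.mul_assoc, hJ]
  simp

lemma matricant_swap_eq (t s : ℝ) : matricant D κt s t =
    -(J (Fin n) ℝ * (matricant D κt t s)ᵀ * J (Fin n) ℝ) := by
  have hright : matricant D κt t s * matricant D κt s t = 1 := by
    rw [matricant_mul, matricant_self]
  have hleft := SymplecticGroup.inv_left_mul_aux (matricant_mem_symplecticGroup D κt t s)
  exact (left_inv_eq_right_inv ((Matrix.neg_mul _ _).trans hleft) hright).symm

lemma continuous_matricant : Continuous fun p : ℝ × ℝ => matricant D κt p.1 p.2 := by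
  have hc : Continuous fun τ => matricant D κt τ 0 :=
    continuous_iff_continuousAt.2 fun τ => (hasDerivAt_matricant D κt τ 0).continuousAt
  have h (p : ℝ × ℝ) : matricant D κt p.1 p.2 = matricant D κt p.1 0 *
      -(J (Fin n) ℝ * (matricant D κt p.2 0)ᵀ * J (Fin n) ℝ) := by
    rw [← matricant_swap_eq, matricant_mul]
  simp_rw [h]
  have := hc.matrix_transpose
  fun_prop

lemma matricant_eq_fromBlocks (t s : ℝ) : matricant D κt t s =
    fromBlocks (lam4 D κt t s)ᵀ (-(lam2 D κt t s)ᵀ) (-(lam3 D κt t s)ᵀ) (lam1 D κt t s)ᵀ := by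
  simp [lam1, lam2, lam3, lam4, fromBlocks_toBlocks]

lemma matricant_swap (t s : ℝ) : matricant D κt s t =
    fromBlocks (lam1 D κt t s) (lam2 D κt t s) (lam3 D κt t s) (lam4 D κt t s) := by
  rw [matricant_swap_eq, matricant_eq_fromBlocks D κt t s, J]
  simp [fromBlocks_transpose, fromBlocks_multiply, fromBlocks_neg]

lemma lam1_swap (t s : ℝ) : lam1 D κt s t = (lam4 D κt t s)ᵀ := by
  rw [lam1, matricant_swap D κt t s, toBlocks_fromBlocks₂₂]

lemma lam3_swap (t s : ℝ) : lam3 D κt s t = -(lam3 D κt t s)ᵀ := by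
  rw [lam3, matricant_swap D κt t s, toBlocks_fromBlocks₂₁]

lemma lam4_swap (t s : ℝ) : lam4 D κt s t = (lam1 D κt t s)ᵀ := by
  rw [lam4, matricant_swap D κt t s, toBlocks_fromBlocks₁₁]

lemma fromBlocks_lam_mul_matricant (t s : ℝ) :
    fromBlocks (lam1 D κt t s) (lam2 D κt t s) (lam3 D κt t s) (lam4 D κt t s) *
      matricant D κt t s = 1 := by
  rw [← matricant_swap, matricant_mul, matricant_self]

lemma lam4_mul_lam1_transpose (t s : ℝ) :
    lam4 D κt t s * (lam1 D κt t s)ᵀ = 1 + lam3 D κt t s * (lam2 D κt t s)ᵀ := by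
  have h := fromBlocks_lam_mul_matricant D κt t s
  rw [matricant_eq_fromBlocks, fromBlocks_multiply, ← fromBlocks_one, fromBlocks_inj] at h
  rw [← h.2.2.2, Matrix.mul_neg]
  abel

lemma lam4_mul_lam3_transpose (t s : ℝ) :
    lam4 D κt t s * (lam3 D κt t s)ᵀ = lam3 D κt t s * (lam4 D κt t s)ᵀ := by
  have h := fromBlocks_lam_mul_matricant D κt t s
  rw [matricant_eq_fromBlocks, fromBlocks_multiply, ← fromBlocks_one, fromBlocks_inj] at h
  have h := h.2.2.1
  rw [Matrix.mul_neg] at h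
  exact (add_neg_eq_zero.1 h).symm

lemma lam3_transpose_mul_lam1 (t s : ℝ) :
    (lam3 D κt t s)ᵀ * lam1 D κt t s = (lam1 D κt t s)ᵀ * lam3 D κt t s := by
  simpa [lam3_swap D κt t s, lam4_swap D κt t s] using (lam4_mul_lam3_transpose D κt s t).symm

variable {D κt} {g g' : ℝ → PhaseVec n × PhaseMat n}

/-- The matrix `J (H_zz + κt (W_zz + W_zw))` of the linear system for the first moments. -/
def meanMatrix (D : Coeffs n) (κt t : ℝ) : PhaseMat n :=
  J (Fin n) ℝ * (D.Hzz t + κt • (D.Wzz t + D.Wzw t))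

lemma continuous_meanMatrix (D : Coeffs n) (κt : ℝ) : Continuous (meanMatrix D κt) :=
  continuous_const.matrix_mul (D.continuous_Hzz.add
    ((D.continuous_Wzz.add D.continuous_Wzw).const_smul κt))

lemma isHESSolution_iff : IsHESSolution D κt g ↔
    (∀ t, HasDerivAt (fun τ => (g τ).1)
      (meanMatrix D κt t *ᵥ (g t).1 + J (Fin n) ℝ *ᵥ D.Hz t) t) ∧
    ∀ t, HasDerivAt (fun τ => (g τ).2)
      (variationMatrix D κt t * (g t).2 + (g t).2 * (variationMatrix D κt t)ᵀ) t := by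
  have hmean (t : ℝ) (z : PhaseVec n) : meanMatrix D κt t *ᵥ z + J (Fin n) ℝ *ᵥ D.Hz t =
      J (Fin n) ℝ *ᵥ (D.Hz t + (D.Hzz t + κt • (D.Wzz t + D.Wzw t)) *ᵥ z) := by
    rw [meanMatrix, ← mulVec_mulVec, ← mulVec_add, add_comm]
  have hcov (t : ℝ) (Δ : PhaseMat n) :
      variationMatrix D κt t * Δ + Δ * (variationMatrix D κt t)ᵀ =
        J (Fin n) ℝ * D.hzz κt t * Δ - Δ * D.hzz κt t * J (Fin n) ℝ := by
    rw [variationMatrix_transpose, variationMatrix, Matrix.mul_neg, ← sub_eq_add_neg,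
      ← Matrix.mul_assoc Δ]
  simp only [hmean, hcov, hasDerivAt_pi, hasDerivAt_matrix_iff, IsHESSolution]

lemma IsHESSolution.snd_eq (hg : IsHESSolution D κt g) (t s : ℝ) :
    (g t).2 = matricant D κt t s * (g s).2 * (matricant D κt t s)ᵀ :=
  lyapunovODE_solution_eq (Δ := fun t => (g t).2) (continuous_variationMatrix D κt)
    (fun t => hasDerivAt_matricant D κt t s) (matricant_self D κt s) (isHESSolution_iff.1 hg).2 t

lemma IsHESSolution.unique (hg : IsHESSolution D κt g) (hg' : IsHESSolution D κt g') {s : ℝ}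
    (h : g s = g' s) : g = g' := by
  have hz : (fun t => (g t).1) = fun t => (g' t).1 := linearODE_solution_unique (s := s)
    (continuous_toContinuousLinearMap_mulVecLin (continuous_meanMatrix D κt))
    (isHESSolution_iff.1 hg).1 (isHESSolution_iff.1 hg').1 (by rw [h])
  funext t
  exact Prod.ext (congrFun hz t) (by rw [hg.snd_eq t s, hg'.snd_eq t s, h])

lemma exists_isHESSolution (s : ℝ) (g₀ : PhaseVec n × PhaseMat n) :
    ∃ g, IsHESSolution D κt g ∧ g s = g₀ := by
  obtain ⟨z, hz, hzs⟩ := exists_linearODE_solution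
    (continuous_toContinuousLinearMap_mulVecLin (continuous_meanMatrix D κt))
    (b := fun t => J (Fin n) ℝ *ᵥ D.Hz t) (continuous_const.matrix_mulVec D.continuous_Hz) s g₀.1
  refine ⟨fun t => (z t, matricant D κt t s * g₀.2 * (matricant D κt t s)ᵀ),
    isHESSolution_iff.2 ⟨hz, fun t => ?_⟩, by simp [hzs, matricant_self]⟩
  exact hasDerivAt_mul_mul_transpose (hasDerivAt_matricant D κt t s) g₀.2

lemma hesSolution_spec (s : ℝ) (g₀ : PhaseVec n × PhaseMat n) :
    IsHESSolution D κt (hesSolution D κt s g₀) ∧ hesSolution D κt s g₀ s = g₀ :=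
  Classical.epsilon_spec (exists_isHESSolution s g₀)

lemma hesSolution_eq_of_isHESSolution (hg : IsHESSolution D κt g) (t : ℝ) :
    hesSolution D κt t (g t) = g :=
  (hesSolution_spec t (g t)).1.unique hg (hesSolution_spec t (g t)).2

end Trajectories

/-! ### Continuation of square roots -/

section SqrtAlong

lemma cpow_half_sq (z : ℂ) : (z ^ (1 / 2 : ℂ)) ^ 2 = z := by
  rw [← Complex.cpow_nat_mul]; norm_num

lemma star_ofReal_cpow_half {c : ℝ} (hc : 0 ≤ c) :
    star ((c : ℂ) ^ (1 / 2 : ℂ)) = (c : ℂ) ^ (1 / 2 : ℂ) := by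
  have h : (c : ℂ) ^ (1 / 2 : ℂ) = ((c ^ (1 / 2 : ℝ) : ℝ) : ℂ) := by
    rw [Complex.ofReal_cpow hc]; norm_num
  rw [h]
  exact Complex.conj_ofReal _

lemma sqrtAlong_self (f : ℝ → ℂ) (s : ℝ) : sqrtAlong f s s = f s ^ (1 / 2 : ℂ) := by
  simp [sqrtAlong]

lemma eq_mul_exp_integral_logDeriv {f : ℝ → ℂ} (hf : Differentiable ℝ f)
    (hlog : Continuous (logDeriv f)) (h0 : ∀ τ, f τ ≠ 0) (s t : ℝ) :
    f t = f s * Complex.exp (∫ τ in s..t, logDeriv f τ) := by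
  have hd (τ : ℝ) :
      HasDerivAt (fun t => f t * Complex.exp (-∫ σ in s..t, logDeriv f σ)) 0 τ := by
    refine ((hf τ).hasDerivAt.mul
      (hlog.integral_hasStrictDerivAt s τ).hasDerivAt.neg.cexp).congr_deriv ?_
    rw [logDeriv_apply]
    field_simp [h0 τ]
    ring
  have hconst := is_const_of_deriv_eq_zero (fun τ => (hd τ).differentiableAt)
    (fun τ => (hd τ).deriv) t s
  rw [intervalIntegral.integral_same, neg_zero, Complex.exp_zero, mul_one] at hconst
  rw [← hconst, mul_assoc, ← Complex.exp_add, neg_add_cancel, Complex.exp_zero, mul_one]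

lemma sqrtAlong_sq {f : ℝ → ℂ} (hf : Differentiable ℝ f) (hlog : Continuous (logDeriv f))
    (h0 : ∀ τ, f τ ≠ 0) (s t : ℝ) : sqrtAlong f s t ^ 2 = f t := by
  rw [sqrtAlong, mul_pow, cpow_half_sq, ← Complex.exp_nat_mul,
    eq_mul_exp_integral_logDeriv hf hlog h0 s t]
  congr 2
  push_cast
  ring

lemma continuous_sqrtAlong {X : Type*} [TopologicalSpace X] [FirstCountableTopology X]
    {F : X → ℝ → ℂ} {a b : X → ℝ} (hlog : Continuous fun p : X × ℝ => logDeriv (F p.1) p.2)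
    (ha : Continuous a) (hb : Continuous b) (hFa : Continuous fun x => F x (a x))
    (hslit : ∀ x, F x (a x) ∈ Complex.slitPlane) :
    Continuous fun x => sqrtAlong (F x) (a x) (b x) := by
  have hint (x : X) (τ₁ τ₂ : ℝ) : IntervalIntegrable (logDeriv (F x)) volume τ₁ τ₂ :=
    (hlog.comp (Continuous.prodMk continuous_const continuous_id)).intervalIntegrable _ _
  have hprimitive {c : X → ℝ} (hc : Continuous c) :
      Continuous fun x => ∫ τ in (0 : ℝ)..c x, logDeriv (F x) τ :=
    intervalIntegral.continuous_parametric_intervalIntegral_of_continuous hlog hc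
  have hsub (x : X) : ∫ τ in a x..b x, logDeriv (F x) τ =
      (∫ τ in (0 : ℝ)..b x, logDeriv (F x) τ) - ∫ τ in (0 : ℝ)..a x, logDeriv (F x) τ :=
    (intervalIntegral.integral_interval_sub_left (hint _ _ _) (hint _ _ _)).symm
  simp only [sqrtAlong, hsub]
  exact (hFa.cpow continuous_const hslit).mul (Complex.continuous_exp.comp
    (continuous_const.mul ((hprimitive hb).sub (hprimitive ha))))

/- The two sides, `F` continued in its first variable from `t` to `u` and the conjugate of `F`
continued from `u` to `t`, are roots of `F u t` that depend continuously on `u` and agree at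
`u = t`. -/
lemma sqrtAlong_swap {F : ℝ → ℝ → ℂ} (hF : ∀ u, Differentiable ℝ fun τ => F τ u)
    (hlog : Continuous fun p : ℝ × ℝ => logDeriv (fun τ => F τ p.1) p.2)
    (h0 : ∀ τ u, F τ u ≠ 0) {c : ℝ} (hc : 0 < c) (hdiag : ∀ u, F u u = c)
    (hswap : ∀ τ u, F u τ = star (F τ u)) (t s : ℝ) :
    sqrtAlong (fun τ => F τ t) t s = star (sqrtAlong (fun τ => F τ s) s t) := by
  have hslit (u : ℝ) : F u u ∈ Complex.slitPlane := by
    rw [hdiag]; exact Complex.ofReal_mem_slitPlane.2 hc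
  have hlog' (u : ℝ) : Continuous (logDeriv fun τ => F τ u) :=
    hlog.comp (continuous_const.prodMk continuous_id)
  have hleft : Continuous fun u => sqrtAlong (fun τ => F τ t) t u :=
    continuous_sqrtAlong (F := fun _ τ => F τ t) ((hlog' t).comp continuous_snd)
      continuous_const continuous_id continuous_const fun _ => hslit t
  have hright : Continuous fun u => star (sqrtAlong (fun τ => F τ u) u t) :=
    (continuous_sqrtAlong (F := fun u τ => F τ u) hlog continuous_id continuous_const
      (by simp only [id, hdiag]; exact continuous_const) hslit).star
  have hleft_sq (u : ℝ) : sqrtAlong (fun τ => F τ t) t u ^ 2 = F u t :=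
    sqrtAlong_sq (hF t) (hlog' t) (fun τ => h0 τ t) t u
  have hright_sq (u : ℝ) : star (sqrtAlong (fun τ => F τ u) u t) ^ 2 = F u t := by
    rw [← star_pow, sqrtAlong_sq (hF u) (hlog' u) (fun τ => h0 τ u), ← hswap]
  refine isPreconnected_univ.eq_of_sq_eq hleft.continuousOn hright.continuousOn
    (fun u _ => (hleft_sq u).trans (hright_sq u).symm) (fun {u} _ hzero => ?_)
    (Set.mem_univ t) ?_ (Set.mem_univ s)
  · exact h0 u t (by rw [← hright_sq u, hzero, zero_pow two_ne_zero])
  · simp only [sqrtAlong_self, hdiag, star_ofReal_cpow_half hc.le]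

lemma exists_tendsto_of_tendsto_sq {R : ℝ → ℂ} {c : ℂ} (hR : ContinuousOn R (Set.Ioi 0))
    (hsq : Tendsto (fun ε => R ε ^ 2) (𝓝[>] 0) (𝓝 c)) (hc : c ≠ 0) :
    ∃ r, r ^ 2 = c ∧ Tendsto R (𝓝[>] 0) (𝓝 r) := by
  have hquot : Tendsto (fun ε => R ε ^ 2 / c) (𝓝[>] 0) (𝓝 1) := by
    simpa [hc] using hsq.div_const c
  obtain ⟨δ, hδ, hslit⟩ := mem_nhdsGT_iff_exists_Ioo_subset.1
    (hquot (Complex.isOpen_slitPlane.mem_nhds Complex.one_mem_slitPlane))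
  have hRδ : ContinuousOn R (Set.Ioo 0 δ) := hR.mono Set.Ioo_subset_Ioi_self
  set r := c ^ (1 / 2 : ℂ)
  set b : ℝ → ℂ := fun ε => r * (R ε ^ 2 / c) ^ (1 / 2 : ℂ)
  have hb_sq (ε : ℝ) : b ε ^ 2 = R ε ^ 2 := by
    simp only [b, mul_pow, r, cpow_half_sq]; field_simp
  have hb_cont : ContinuousOn b (Set.Ioo 0 δ) :=
    continuousOn_const.mul (((hRδ.pow 2).div_const c).cpow continuousOn_const fun ε hε => hslit hε)
  have hb_lim : Tendsto b (𝓝[>] 0) (𝓝 r) := by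
    simpa [b] using (hquot.cpow tendsto_const_nhds Complex.one_mem_slitPlane).const_mul r
  have hb_ne : ∀ ε ∈ Set.Ioo 0 δ, b ε ≠ 0 := fun ε hε h =>
    Complex.slitPlane_ne_zero (hslit hε) (by simp [← hb_sq, h])
  have hmem : Set.Ioo 0 δ ∈ 𝓝[>] (0 : ℝ) := Ioo_mem_nhdsGT hδ
  rcases isPreconnected_Ioo.eq_or_eq_neg_of_sq_eq hRδ hb_cont
    (fun ε _ => (hb_sq ε).symm) (fun {ε} hε => hb_ne ε hε) with h | h
  · exact ⟨r, cpow_half_sq c, hb_lim.congr' (by filter_upwards [hmem] with ε hε using (h hε).symm)⟩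
  · refine ⟨-r, by rw [neg_sq, cpow_half_sq], hb_lim.neg.congr' ?_⟩
    filter_upwards [hmem] with ε hε using (h hε).symm

end SqrtAlong

/-! ### The regularized determinant -/

section RegularizedDeterminant

variable {n : ℕ}

/-- The matrix `-i2πħ(λ₃ + iε(λ₁ + λ₄) - ε²λ₂)` whose determinant is `regDet`, as a function of
the phase space matrix `A = [[λ₄ᵀ, -λ₂ᵀ], [-λ₃ᵀ, λ₁ᵀ]]`. -/
noncomputable def regMatrix (ħ ε : ℝ) (A : PhaseMat n) : Matrix (Fin n) (Fin n) ℂ :=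
  (-Complex.I * 2 * Real.pi * ħ) •
    ((-A.toBlocks₂₁ᵀ).map Complex.ofReal +
      (Complex.I * ε) • (A.toBlocks₂₂ᵀ + A.toBlocks₁₁ᵀ).map Complex.ofReal -
      ((ε : ℂ) ^ 2) • (-A.toBlocks₁₂ᵀ).map Complex.ofReal)

lemma regDet_eq (D : Coeffs n) (ħ κt ε t s : ℝ) :
    regDet D ħ κt ε t s = (regMatrix ħ ε (matricant D κt t s)).det := rfl

lemma regMatrix_apply (ħ ε : ℝ) (A : PhaseMat n) (i j : Fin n) : regMatrix ħ ε A i j =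
    (-Complex.I * 2 * Real.pi * ħ) * (-(A (Sum.inr j) (Sum.inl i) : ℂ) +
      Complex.I * ε * (A (Sum.inr j) (Sum.inr i) + A (Sum.inl j) (Sum.inl i)) +
      (ε : ℂ) ^ 2 * A (Sum.inl j) (Sum.inr i)) := by
  simp [regMatrix, toBlocks₁₁, toBlocks₁₂, toBlocks₂₁, toBlocks₂₂]

lemma continuous_regMatrix {X : Type*} [TopologicalSpace X] (ħ : ℝ) {ε : X → ℝ}
    {A : X → PhaseMat n} (hε : Continuous ε) (hA : Continuous A) :
    Continuous fun x => regMatrix ħ (ε x) (A x) := by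
  refine continuous_matrix fun i j => ?_
  have hA' (k l : Fin n ⊕ Fin n) : Continuous fun x => A x k l := hA.matrix_elem k l
  simp only [regMatrix_apply]
  fun_prop

lemma hasDerivAt_regMatrix (ħ ε : ℝ) {A : ℝ → PhaseMat n} {A' : PhaseMat n} {τ : ℝ}
    (hA : HasDerivAt A A' τ) :
    HasDerivAt (fun τ => regMatrix ħ ε (A τ)) (regMatrix ħ ε A') τ := by
  refine hasDerivAt_matrix_iff.2 fun i j => ?_
  have h (k l : Fin n ⊕ Fin n) := (hasDerivAt_matrix_iff.1 hA k l).ofReal_comp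
  simp only [regMatrix_apply]
  exact (((h _ _).neg.add (((h _ _).add (h _ _)).const_mul _)).add
    ((h _ _).const_mul _)).const_mul _

/- With `u = A (v, -iεv)` this reads `-i2πħ (iε u₁ - u₂)`. -/
lemma regMatrix_transpose_mulVec (ħ ε : ℝ) (A : PhaseMat n) (v : Fin n → ℂ) :
    (regMatrix ħ ε A)ᵀ *ᵥ v = (-Complex.I * 2 * Real.pi * ħ) •
      ((Complex.I * ε) •
        (A.map Complex.ofReal *ᵥ Sum.elim v ((-(Complex.I * ε)) • v)) ∘ Sum.inl -
        (A.map Complex.ofReal *ᵥ Sum.elim v ((-(Complex.I * ε)) • v)) ∘ Sum.inr) := by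
  ext i
  simp only [mulVec, dotProduct, transpose_apply, regMatrix_apply, Pi.smul_apply, Pi.sub_apply,
    Function.comp_apply, Fintype.sum_sum_type, Sum.elim_inl, Sum.elim_inr, map_apply, smul_eq_mul,
    ← Finset.sum_add_distrib, Finset.mul_sum, ← Finset.sum_sub_distrib]
  refine Finset.sum_congr rfl fun j _ => ?_
  linear_combination (-Complex.I * 2 * Real.pi * ħ * ε ^ 2 * A (Sum.inl i) (Sum.inr j) * v j) *
    Complex.I_sq

lemma star_mulVec_dotProduct_J_mulVec {A : PhaseMat n} (hA : A ∈ symplecticGroup (Fin n) ℝ)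
    (w : Fin n ⊕ Fin n → ℂ) :
    star (A.map Complex.ofReal *ᵥ w) ⬝ᵥ (J (Fin n) ℂ *ᵥ (A.map Complex.ofReal *ᵥ w)) =
      star w ⬝ᵥ (J (Fin n) ℂ *ᵥ w) := by
  have hJ : (A.map Complex.ofReal)ᴴ * J (Fin n) ℂ * A.map Complex.ofReal = J (Fin n) ℂ := by
    have h := congrArg (fun M : PhaseMat n => M.map Complex.ofRealHom)
      (SymplecticGroup.mem_iff'.1 hA)
    simp only [Matrix.map_mul, map_J] at h
    rwa [show (A.map Complex.ofReal)ᴴ = Aᵀ.map Complex.ofReal by ext; simp]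
  rw [star_mulVec, ← dotProduct_mulVec, mulVec_mulVec, mulVec_mulVec, hJ]

lemma star_sumElim_dotProduct_J_mulVec (v : Fin n → ℂ) (c : ℂ) :
    star (Sum.elim v (c • v)) ⬝ᵥ (J (Fin n) ℂ *ᵥ Sum.elim v (c • v)) =
      (star c - c) * (star v ⬝ᵥ v) := by
  rw [Function.star_sumElim, star_smul, J, fromBlocks_mulVec, sumElim_dotProduct_sumElim]
  simp only [Sum.elim_comp_inl, zero_mulVec, Sum.elim_comp_inr, neg_mulVec, one_mulVec, zero_add,
    dotProduct_neg, dotProduct_smul, smul_eq_mul, RCLike.star_def, add_zero, smul_dotProduct]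
  ring

open scoped ComplexOrder in
/- A vector `v` in the kernel of the transpose makes `u = A (v, -iεv)` satisfy `u₂ = iεu₁`, so the
invariant Hermitian form `⟨·, J ·⟩` has opposite signs on the two sides of `u = A (v, -iεv)`. -/
lemma det_regMatrix_ne_zero {ħ ε : ℝ} (hħ : ħ ≠ 0) (hε : ε ≠ 0) {A : PhaseMat n}
    (hA : A ∈ symplecticGroup (Fin n) ℝ) : (regMatrix ħ ε A).det ≠ 0 := by
  intro hdet
  rw [← det_transpose] at hdet
  obtain ⟨v, hv0, hv⟩ := exists_mulVec_eq_zero_iff.2 hdet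
  set u := A.map Complex.ofReal *ᵥ Sum.elim v ((-(Complex.I * ε)) • v) with hu
  have hu₂ : u ∘ Sum.inr = (Complex.I * (ε : ℂ)) • u ∘ Sum.inl := by
    rw [regMatrix_transpose_mulVec] at hv
    exact (sub_eq_zero.1 ((smul_eq_zero_iff_right (by simp [Real.pi_ne_zero, hħ])).1 hv)).symm
  have hu_eq : u = Sum.elim (u ∘ Sum.inl) ((Complex.I * (ε : ℂ)) • u ∘ Sum.inl) := by
    rw [← hu₂, Sum.elim_comp_inl_inr]
  have hform := star_mulVec_dotProduct_J_mulVec hA (Sum.elim v ((-(Complex.I * ε)) • v))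
  rw [← hu, hu_eq, star_sumElim_dotProduct_J_mulVec, star_sumElim_dotProduct_J_mulVec] at hform
  have hsum : star (u ∘ Sum.inl) ⬝ᵥ (u ∘ Sum.inl) + star v ⬝ᵥ v = 0 := by
    have hc : -2 * Complex.I * (ε : ℂ) ≠ 0 := by simp [hε]
    refine (mul_eq_zero.1 ?_).resolve_left hc
    simp only [star_mul', Complex.star_def, Complex.conj_I, Complex.conj_ofReal, star_neg] at hform
    linear_combination hform
  exact hv0 (dotProduct_star_self_eq_zero.1 ((add_eq_zero_iff_of_nonneg
    (dotProduct_star_self_nonneg _) (dotProduct_star_self_nonneg _)).1 hsum).2)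

lemma regDet_ne_zero (D : Coeffs n) {ħ ε : ℝ} (hħ : ħ ≠ 0) (hε : ε ≠ 0) (κt t s : ℝ) :
    regDet D ħ κt ε t s ≠ 0 :=
  det_regMatrix_ne_zero hħ hε (matricant_mem_symplecticGroup D κt t s)

lemma regDet_self (D : Coeffs n) (ħ κt ε s : ℝ) :
    regDet D ħ κt ε s s = ((4 * Real.pi * ħ * ε) ^ n : ℝ) := by
  have h : regMatrix ħ ε (1 : PhaseMat n) = ((4 * Real.pi * ħ * ε : ℝ) : ℂ) • 1 := by
    ext i j
    rw [regMatrix_apply]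
    by_cases hij : i = j
    · subst hij
      simp only [neg_mul, ne_eq, reduceCtorEq, not_false_eq_true, one_apply_ne, Complex.ofReal_zero,
        neg_zero, one_apply_eq, Complex.ofReal_one, zero_add, mul_zero, add_zero,
        Complex.ofReal_mul, Complex.ofReal_ofNat, Matrix.smul_apply, smul_eq_mul, mul_one]
      linear_combination (-4 * (Real.pi : ℂ) * ħ * ε) * Complex.I_sq
    · simp [hij, Ne.symm hij]
  rw [regDet_eq, matricant_self, h, det_smul]
  simp

lemma regDet_swap (D : Coeffs n) (ħ κt ε t s : ℝ) :
    regDet D ħ κt ε s t = star (regDet D ħ κt ε t s) := by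
  have h : regMatrix ħ ε (matricant D κt s t) = (regMatrix ħ ε (matricant D κt t s))ᴴ := by
    ext i j
    rw [conjTranspose_apply, regMatrix_apply, regMatrix_apply, matricant_swap D κt t s]
    simp only [neg_mul, lam1, toBlocks₂₂, lam2, toBlocks₁₂, lam3, toBlocks₂₁, lam4, toBlocks₁₁,
      fromBlocks_apply₂₁, Matrix.neg_apply, transpose_apply, of_apply, Complex.ofReal_neg, neg_neg,
      fromBlocks_apply₂₂, fromBlocks_apply₁₁, fromBlocks_apply₁₂, mul_neg, star_neg, star_mul',
      RCLike.star_def, Complex.conj_I, star_ofNat, Complex.conj_ofReal, star_add, star_pow]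
    ring
  rw [regDet_eq, regDet_eq, h, det_conjTranspose]

lemma regDet_zero (D : Coeffs n) (ħ κt t s : ℝ) :
    regDet D ħ κt 0 t s = (-Complex.I * 2 * Real.pi * ħ) ^ n * (lam3 D κt t s).det := by
  simp only [regDet, Complex.ofReal_zero, mul_zero, zero_smul, add_zero, ne_eq,
    OfNat.ofNat_ne_zero, not_false_eq_true, zero_pow, sub_zero, det_smul, Fintype.card_fin]
  congr 1
  exact (Complex.ofRealHom.map_det _).symm

lemma hasDerivAt_regDet (D : Coeffs n) (ħ κt ε s τ : ℝ) :
    HasDerivAt (fun τ => regDet D ħ κt ε τ s)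
      (fderiv ℝ (fun M : Matrix (Fin n) (Fin n) ℂ => M.det)
        (regMatrix ħ ε (matricant D κt τ s))
        (regMatrix ħ ε (variationMatrix D κt τ * matricant D κt τ s))) τ :=
  ((contDiff_det.differentiable one_ne_zero _).hasFDerivAt).comp_hasDerivAt τ
    (hasDerivAt_regMatrix ħ ε (hasDerivAt_matricant D κt τ s))

lemma differentiable_regDet (D : Coeffs n) (ħ κt ε s : ℝ) :
    Differentiable ℝ fun τ => regDet D ħ κt ε τ s :=
  fun τ => (hasDerivAt_regDet D ħ κt ε s τ).differentiableAt

section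

variable {X : Type*} [TopologicalSpace X] (D : Coeffs n) (κt : ℝ) {ε τ s : X → ℝ}

lemma continuous_matricant_comp (hτ : Continuous τ) (hs : Continuous s) :
    Continuous fun x => matricant D κt (τ x) (s x) :=
  Continuous.comp (g := fun p : ℝ × ℝ => matricant D κt p.1 p.2) (continuous_matricant D κt)
    (hτ.prodMk hs)

lemma continuous_regDet (ħ : ℝ) (hε : Continuous ε) (hτ : Continuous τ) (hs : Continuous s) :
    Continuous fun x => regDet D ħ κt (ε x) (τ x) (s x) :=
  (continuous_regMatrix ħ hε (continuous_matricant_comp D κt hτ hs)).matrix_det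

lemma continuous_logDeriv_regDet {ħ : ℝ} (hħ : ħ ≠ 0) (hε : Continuous ε)
    (hε0 : ∀ x, ε x ≠ 0) (hτ : Continuous τ) (hs : Continuous s) :
    Continuous fun x => logDeriv (fun τ => regDet D ħ κt (ε x) τ (s x)) (τ x) := by
  have hA := continuous_matricant_comp D κt hτ hs
  have hderiv := ((contDiff_det.continuous_fderiv one_ne_zero).comp
    (continuous_regMatrix ħ hε hA)).clm_apply (continuous_regMatrix ħ hε
      (((continuous_variationMatrix D κt).comp hτ).matrix_mul hA))
  simp only [logDeriv_apply, (hasDerivAt_regDet D ħ κt _ _ _).deriv]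
  exact hderiv.div (continuous_regDet D κt ħ hε hτ hs)
    fun x => regDet_ne_zero D hħ (hε0 x) κt _ _

end

end RegularizedDeterminant

/-! ### The branch of the root in the Green function -/

section SqrtDet

variable {n : ℕ} (D : Coeffs n) {ħ : ℝ} (hħ : 0 < ħ) (κt t s : ℝ)
include hħ

lemma sqrtAlong_regDet_sq {ε : ℝ} (hε : ε ≠ 0) :
    sqrtAlong (fun τ => regDet D ħ κt ε τ s) s t ^ 2 = regDet D ħ κt ε t s :=
  sqrtAlong_sq (differentiable_regDet D ħ κt ε s)
    (continuous_logDeriv_regDet D κt hħ.ne' continuous_const (fun _ => hε) continuous_id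
      continuous_const) (fun τ => regDet_ne_zero D hħ.ne' hε κt τ s) s t

lemma sqrtAlong_regDet_swap {ε : ℝ} (hε : 0 < ε) :
    sqrtAlong (fun τ => regDet D ħ κt ε τ t) t s =
      star (sqrtAlong (fun τ => regDet D ħ κt ε τ s) s t) :=
  sqrtAlong_swap (F := regDet D ħ κt ε) (differentiable_regDet D ħ κt ε)
    (continuous_logDeriv_regDet D κt hħ.ne' continuous_const (fun _ => hε.ne') continuous_snd
      continuous_fst) (regDet_ne_zero D hħ.ne' hε.ne' κt)
    (c := (4 * Real.pi * ħ * ε) ^ n) (by positivity) (regDet_self D ħ κt ε)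
    (regDet_swap D ħ κt ε) t s

lemma continuousOn_sqrtAlong_regDet :
    ContinuousOn (fun ε => sqrtAlong (fun τ => regDet D ħ κt ε τ s) s t) (Set.Ioi 0) := by
  rw [continuousOn_iff_continuous_domRestrict]
  refine continuous_sqrtAlong (X := Set.Ioi (0 : ℝ)) (a := fun _ => s) (b := fun _ => t)
    (F := fun ε τ => regDet D ħ κt ε τ s)
    (continuous_logDeriv_regDet D κt hħ.ne' (continuous_subtype_val.comp continuous_fst)
      (fun p => (Set.mem_Ioi.1 p.1.2).ne') continuous_snd continuous_const)
    continuous_const continuous_const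
    (continuous_regDet D κt ħ continuous_subtype_val continuous_const continuous_const)
    fun ε => ?_
  have hε : (0 : ℝ) < ε := ε.2
  rw [regDet_self]
  exact Complex.ofReal_mem_slitPlane.2 (by positivity)

variable {κt t s} (hdet : (lam3 D κt t s).det ≠ 0)
include hdet

lemma exists_tendsto_sqrtAlong_regDet :
    ∃ r, r ^ 2 = regDet D ħ κt 0 t s ∧
      Tendsto (fun ε => sqrtAlong (fun τ => regDet D ħ κt ε τ s) s t) (𝓝[>] 0) (𝓝 r) := by
  have hlim : Tendsto (fun ε => regDet D ħ κt ε t s) (𝓝[>] 0) (𝓝 (regDet D ħ κt 0 t s)) :=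
    ((continuous_regDet D κt ħ continuous_id continuous_const continuous_const).tendsto
      0).mono_left nhdsWithin_le_nhds
  refine exists_tendsto_of_tendsto_sq (continuousOn_sqrtAlong_regDet D hħ κt t s)
    (hlim.congr' ?_) ?_
  · filter_upwards [self_mem_nhdsWithin] with ε hε
    exact (sqrtAlong_regDet_sq D hħ κt t s (Set.mem_Ioi.1 hε).ne').symm
  · rw [regDet_zero]
    exact mul_ne_zero (pow_ne_zero _ (by simp [Real.pi_ne_zero, hħ.ne']))
      (Complex.ofReal_ne_zero.2 hdet)

lemma sqrtDet_sq :
    sqrtDet D ħ κt t s ^ 2 = (-Complex.I * 2 * Real.pi * ħ) ^ n * (lam3 D κt t s).det := by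
  obtain ⟨r, hr, hlim⟩ := exists_tendsto_sqrtAlong_regDet D hħ hdet
  rw [sqrtDet, hlim.limUnder_eq, hr, regDet_zero]

lemma sqrtDet_swap : sqrtDet D ħ κt s t = star (sqrtDet D ħ κt t s) := by
  obtain ⟨r, -, hlim⟩ := exists_tendsto_sqrtAlong_regDet D hħ hdet
  have hlim' : Tendsto (fun ε => sqrtAlong (fun τ => regDet D ħ κt ε τ t) t s) (𝓝[>] 0)
      (𝓝 (star r)) := by
    refine ((continuous_star.tendsto r).comp hlim).congr' ?_
    filter_upwards [self_mem_nhdsWithin] with ε hε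
    exact (sqrtAlong_regDet_swap D hħ κt t s hε).symm
  rw [sqrtDet, sqrtDet, hlim.limUnder_eq, hlim'.limUnder_eq]

lemma norm_sqrtDet_sq :
    ‖sqrtDet D ħ κt t s‖ ^ 2 = (2 * Real.pi * ħ) ^ n * |(lam3 D κt t s).det| := by
  rw [← norm_pow, sqrtDet_sq D hħ hdet]
  simp [abs_of_pos Real.pi_pos, abs_of_pos hħ]

end SqrtDet

section SchwartzOperators

open scoped SchwartzMap FourierTransform LineDeriv

variable {𝕍 : Type*} [NormedAddCommGroup 𝕍] [InnerProductSpace ℝ 𝕍]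

/-! ### Oscillating factors -/

lemma hasTemperateGrowth_cexp_I_mul :
    Function.HasTemperateGrowth fun r : ℝ => Complex.exp (Complex.I * r) := by
  have hderiv (r : ℝ) : HasDerivAt (fun r : ℝ => Complex.exp (Complex.I * r))
      (Complex.I * Complex.exp (Complex.I * r)) r := by
    simpa only [Complex.ofRealCLM_apply, Complex.ofReal_one, mul_one, mul_comm] using
      ((Complex.ofRealCLM.hasDerivAt (x := r)).const_mul Complex.I).cexp
  have hiter (k : ℕ) : iteratedDeriv k (fun r : ℝ => Complex.exp (Complex.I * r)) =
      fun r : ℝ => Complex.I ^ k * Complex.exp (Complex.I * r) := by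
    induction k with
    | zero => simp
    | succ k ih =>
      rw [iteratedDeriv_succ, ih]
      funext r
      rw [((hderiv r).const_mul _).deriv]
      ring
  refine ⟨Complex.contDiff_exp.comp (contDiff_const.mul Complex.ofRealCLM.contDiff),
    fun k => ⟨0, 1, fun r => ?_⟩⟩
  rw [norm_iteratedFDeriv_eq_norm_iteratedDeriv, hiter]
  simp [mul_comm Complex.I, Complex.norm_exp_ofReal_mul_I]

/-- The oscillating factor `e^{iq/ħ}` with the real phase `q`. -/
noncomputable def phaseFactor {X : Type*} (ħ : ℝ) (q : X → ℝ) (x : X) : ℂ :=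
  Complex.exp (Complex.I / ħ * q x)

lemma star_phaseFactor_mul_self {X : Type*} (ħ : ℝ) (q : X → ℝ) (x : X) :
    star (phaseFactor ħ q x) * phaseFactor ħ q x = 1 := by
  rw [phaseFactor, Complex.star_def, ← Complex.exp_conj, ← Complex.exp_add]
  simp [neg_div]

lemma hasTemperateGrowth_phaseFactor (ħ : ℝ) {q : 𝕍 → ℝ} (hq : q.HasTemperateGrowth) :
    (phaseFactor ħ q).HasTemperateGrowth := by
  have h : phaseFactor ħ q = (fun r : ℝ => Complex.exp (Complex.I * r)) ∘ fun x => ħ⁻¹ * q x := by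
    funext x
    simp only [phaseFactor, Function.comp_apply, Complex.ofReal_mul, Complex.ofReal_inv,
      div_eq_mul_inv, mul_assoc]
  rw [h]
  exact hasTemperateGrowth_cexp_I_mul.comp ((Function.HasTemperateGrowth.const ħ⁻¹).mul hq)

lemma hasLineDerivAt_phaseFactor_mul {ħ : ℝ} {q : 𝕍 → ℝ} {q' : ℝ} {f : 𝕍 → ℂ} {f' : ℂ} {x m : 𝕍}
    (hq : HasLineDerivAt ℝ q q' x m) (hf : HasLineDerivAt ℝ f f' x m) :
    HasLineDerivAt ℝ (fun x => phaseFactor ħ q x * f x)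
      (phaseFactor ħ q x * (Complex.I / ħ * q' * f x + f')) x m := by
  have h := ((hq.ofReal_comp.const_mul (Complex.I / ħ)).cexp).mul hf
  refine HasDerivAt.congr_deriv h ?_
  simp only [phaseFactor, zero_smul, add_zero]
  ring

/-- Multiplication by `e^{iq/ħ}` on Schwartz functions; `q` has to be of temperate growth. -/
noncomputable def phaseMul (ħ : ℝ) (q : 𝕍 → ℝ) : 𝓢(𝕍, ℂ) →L[ℂ] 𝓢(𝕍, ℂ) :=
  SchwartzMap.smulLeftCLM ℂ (phaseFactor ħ q)

lemma phaseMul_apply (ħ : ℝ) {q : 𝕍 → ℝ} (hq : q.HasTemperateGrowth) (f : 𝓢(𝕍, ℂ)) (x : 𝕍) :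
    phaseMul ħ q f x = phaseFactor ħ q x * f x := by
  rw [phaseMul, SchwartzMap.smulLeftCLM_apply_apply (hasTemperateGrowth_phaseFactor ħ hq),
    smul_eq_mul]

lemma hasLineDerivAt_schwartz (f : 𝓢(𝕍, ℂ)) (x m : 𝕍) :
    HasLineDerivAt ℝ f ((∂_{m} f : 𝓢(𝕍, ℂ)) x) x m := by
  rw [SchwartzMap.lineDerivOp_apply_eq_fderiv]
  exact f.differentiableAt.hasFDerivAt.hasLineDerivAt m

lemma lineDerivOp_phaseMul_apply (ħ : ℝ) {q : 𝕍 → ℝ} (hq : q.HasTemperateGrowth) {q' : ℝ}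
    {x m : 𝕍} (hq' : HasLineDerivAt ℝ q q' x m) (f : 𝓢(𝕍, ℂ)) :
    (∂_{m} (phaseMul ħ q f) : 𝓢(𝕍, ℂ)) x =
      phaseFactor ħ q x * (Complex.I / ħ * q' * f x + (∂_{m} f : 𝓢(𝕍, ℂ)) x) := by
  rw [SchwartzMap.lineDerivOp_apply, funext (phaseMul_apply ħ hq f)]
  exact (hasLineDerivAt_phaseFactor_mul hq' (hasLineDerivAt_schwartz f x m)).lineDeriv

/-! ### Isometries of the Schwartz space -/

variable [FiniteDimensional ℝ 𝕍] [MeasurableSpace 𝕍] [BorelSpace 𝕍]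

/-- The scalar product `⟨f, h⟩` of `L²` on Schwartz functions, antilinear in `f`. -/
noncomputable def pairing (f : 𝓢(𝕍, ℂ)) : 𝓢(𝕍, ℂ) →L[ℂ] ℂ :=
  innerSL ℂ (f.toLp 2 volume) ∘L SchwartzMap.toLpCLM ℂ ℂ 2 volume

lemma pairing_apply (f h : 𝓢(𝕍, ℂ)) : pairing f h = ∫ x, star (f x) * h x := by
  simp [pairing, RCLike.inner_apply, mul_comm]

lemma eq_zero_of_pairing_self_eq_zero {f : 𝓢(𝕍, ℂ)} (h : pairing f f = 0) : f = 0 := by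
  have hLp : f.toLp 2 (volume : Measure 𝕍) = 0 := inner_self_eq_zero.1 h
  exact SchwartzMap.injective_toLp 2 volume
    (hLp.trans (SchwartzMap.toLpCLM ℂ ℂ 2 volume).map_zero.symm)

/-- Operators on the Schwartz space which are isometric for the `L²` norm. -/
def PreservesPairing (T : 𝓢(𝕍, ℂ) →L[ℂ] 𝓢(𝕍, ℂ)) : Prop :=
  ∀ f h, pairing (T f) (T h) = pairing f h

lemma PreservesPairing.comp {T' T : 𝓢(𝕍, ℂ) →L[ℂ] 𝓢(𝕍, ℂ)} (hT' : PreservesPairing T')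
    (hT : PreservesPairing T) : PreservesPairing (T' ∘L T) :=
  fun f h => (hT' (T f) (T h)).trans (hT f h)

lemma preservesPairing_phaseMul (ħ : ℝ) {q : 𝕍 → ℝ} (hq : q.HasTemperateGrowth) :
    PreservesPairing (phaseMul ħ q) := by
  intro f h
  rw [pairing_apply, pairing_apply]
  congr 1 with x
  rw [phaseMul_apply ħ hq, phaseMul_apply ħ hq, star_mul']
  linear_combination (star (f x) * h x) * star_phaseFactor_mul_self ħ q x

/-- The Fourier transform with the argument transformed by `L`, that is, the operator with the
kernel `c e^{-2πi⟨y, Lx⟩}`. -/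
noncomputable def dilatedFourier (c : ℂ) (L : 𝕍 ≃L[ℝ] 𝕍) : 𝓢(𝕍, ℂ) →L[ℂ] 𝓢(𝕍, ℂ) :=
  c • (SchwartzMap.compCLMOfContinuousLinearEquiv ℂ L ∘L FourierTransform.fourierCLM ℂ 𝓢(𝕍, ℂ))

variable (c : ℂ) (L : 𝕍 ≃L[ℝ] 𝕍)

lemma dilatedFourier_apply (f : 𝓢(𝕍, ℂ)) (x : 𝕍) : dilatedFourier c L f x = c * 𝓕 f (L x) := rfl

lemma dilatedFourier_eq_integral (f : 𝓢(𝕍, ℂ)) (x : 𝕍) :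
    dilatedFourier c L f x =
      ∫ y, c * Complex.exp ((-2 * Real.pi * inner ℝ y (L x) : ℝ) * Complex.I) * f y := by
  simp only [dilatedFourier_apply, SchwartzMap.fourier_coe, Real.fourier_eq', smul_eq_mul,
    mul_assoc, integral_const_mul]

lemma integral_comp_clEquiv {F : Type*} [NormedAddCommGroup F] [NormedSpace ℝ F] (h : 𝕍 → F) :
    ∫ x, h (L x) = |(LinearMap.det (L : 𝕍 →ₗ[ℝ] 𝕍))⁻¹| • ∫ x, h x := by
  have hdet : LinearMap.det (L : 𝕍 →ₗ[ℝ] 𝕍) ≠ 0 := L.toLinearEquiv.isUnit_det'.ne_zero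
  have hmap : ∫ y, h y ∂(Measure.map (L : 𝕍 →ₗ[ℝ] 𝕍) volume) = ∫ x, h (L x) :=
    L.toHomeomorph.measurableEmbedding.integral_map h
  rw [← hmap, Measure.map_linearMap_addHaar_eq_smul_addHaar volume hdet, integral_smul_measure,
    ENNReal.toReal_ofReal (abs_nonneg _)]

variable {c L}

lemma star_mul_mul_integral_comp_clEquiv (hc : ‖c‖ ^ 2 = |LinearMap.det (L : 𝕍 →ₗ[ℝ] 𝕍)|)
    (h : 𝕍 → ℂ) : star c * c * ∫ x, h (L x) = ∫ x, h x := by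
  have hdet : LinearMap.det (L : 𝕍 →ₗ[ℝ] 𝕍) ≠ 0 := L.toLinearEquiv.isUnit_det'.ne_zero
  rw [Complex.star_def, Complex.conj_mul', ← Complex.ofReal_pow, hc, integral_comp_clEquiv,
    Complex.real_smul, ← mul_assoc, ← Complex.ofReal_mul, abs_inv,
    mul_inv_cancel₀ (abs_ne_zero.2 hdet), Complex.ofReal_one, one_mul]

lemma preservesPairing_dilatedFourier (hc : ‖c‖ ^ 2 = |LinearMap.det (L : 𝕍 →ₗ[ℝ] 𝕍)|) :
    PreservesPairing (dilatedFourier c L) := by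
  intro f h
  calc pairing (dilatedFourier c L f) (dilatedFourier c L h)
      = ∫ x, star c * c * (star (𝓕 f (L x)) * 𝓕 h (L x)) := by
        rw [pairing_apply]
        congr 1 with x
        rw [dilatedFourier_apply, dilatedFourier_apply, star_mul', mul_mul_mul_comm]
    _ = ∫ x, star (𝓕 f x) * 𝓕 h x := by
        rw [integral_const_mul,
          star_mul_mul_integral_comp_clEquiv hc fun ξ => star (𝓕 f ξ) * 𝓕 h ξ]
    _ = pairing f h := by
        simpa [RCLike.inner_apply, mul_comm, pairing_apply] using
          SchwartzMap.integral_inner_fourier_fourier f h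

lemma integral_adjoint_kernel_mul_dilatedFourier
    (hc : ‖c‖ ^ 2 = |LinearMap.det (L : 𝕍 →ₗ[ℝ] 𝕍)|) (f : 𝓢(𝕍, ℂ)) (x : 𝕍) :
    ∫ y, star (c * Complex.exp ((-2 * Real.pi * inner ℝ x (L y) : ℝ) * Complex.I)) *
      dilatedFourier c L f y = f x := by
  calc _ = ∫ y, star c * c *
        (Complex.exp ((2 * Real.pi * inner ℝ (L y) x : ℝ) * Complex.I) * 𝓕 f (L y)) := by
        congr 1 with y
        rw [dilatedFourier_apply, star_mul', Complex.star_def, ← Complex.exp_conj, map_mul,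
          Complex.conj_ofReal, Complex.conj_I, real_inner_comm, mul_neg, ← neg_mul,
          ← Complex.ofReal_neg, neg_mul, neg_mul, neg_neg]
        ring
    _ = ∫ ξ, Complex.exp ((2 * Real.pi * inner ℝ ξ x : ℝ) * Complex.I) * 𝓕 f ξ := by
        rw [integral_const_mul, star_mul_mul_integral_comp_clEquiv hc fun ξ =>
          Complex.exp ((2 * Real.pi * inner ℝ ξ x : ℝ) * Complex.I) * 𝓕 f ξ]
    _ = 𝓕⁻ (𝓕 f) x := by rw [SchwartzMap.fourierInv_coe, Real.fourierInv_eq']; rfl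
    _ = f x := by rw [FourierTransform.fourierInv_fourier_eq]

lemma lineDerivOp_dilatedFourier (f : 𝓢(𝕍, ℂ)) (m : 𝕍) :
    ∂_{m} (dilatedFourier c L f) = dilatedFourier c L
      (-(2 * Real.pi * Complex.I) • SchwartzMap.smulLeftCLM ℂ (inner ℝ · (L m)) f) := by
  ext x
  simp only [dilatedFourier, _root_.smul_apply, ContinuousLinearMap.comp_apply,
    FourierTransform.fourierCLM_apply, LineDeriv.lineDerivOp_smul,
    SchwartzMap.lineDerivOp_compCLMOfContinuousLinearEquiv, SchwartzMap.lineDerivOp_fourier_eq]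

lemma inner_mul_dilatedFourier_apply (f : 𝓢(𝕍, ℂ)) (x m : 𝕍) :
    (2 * Real.pi * Complex.I) * (inner ℝ (L x) m : ℝ) * dilatedFourier c L f x =
      dilatedFourier c L (∂_{m} f) x := by
  have hinner : (inner ℝ · m : 𝕍 → ℝ).HasTemperateGrowth := by fun_prop
  rw [dilatedFourier_apply, dilatedFourier_apply, SchwartzMap.fourier_lineDerivOp_eq,
    _root_.smul_apply, SchwartzMap.smulLeftCLM_apply_apply hinner, smul_eq_mul,
    Complex.real_smul]
  ring

end SchwartzOperators

section CanonicalOperators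

variable {n : ℕ}

open scoped SchwartzMap LineDeriv

/-! ### The canonical operators on Schwartz functions -/

lemma hasTemperateGrowth_coord (j : Fin n) :
    Function.HasTemperateGrowth fun x : EuclideanSpace ℝ (Fin n) => x j :=
  (EuclideanSpace.proj (𝕜 := ℝ) j).hasTemperateGrowth

lemma hasTemperateGrowth_coord_ofReal (j : Fin n) :
    Function.HasTemperateGrowth fun x : EuclideanSpace ℝ (Fin n) => (x j : ℂ) :=
  Complex.ofRealCLM.hasTemperateGrowth.comp (hasTemperateGrowth_coord j)

/-- The operators `ẑ = (p̂, x)` of `zOp` on Schwartz functions. -/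
noncomputable def zSchwartz (ħ : ℝ) :
    Fin n ⊕ Fin n → 𝓢(EuclideanSpace ℝ (Fin n), ℂ) →L[ℂ] 𝓢(EuclideanSpace ℝ (Fin n), ℂ)
  | Sum.inl j => (-Complex.I * ħ) • LineDeriv.lineDerivOpCLM ℂ _ (EuclideanSpace.single j (1 : ℝ))
  | Sum.inr j => SchwartzMap.smulLeftCLM ℂ (fun x => (x j : ℂ))

/-- The centred operators `Δẑ = ẑ - z` of `dzOp` on Schwartz functions. -/
noncomputable def dzSchwartz (ħ : ℝ) (z : PhaseVec n) (k : Fin n ⊕ Fin n) :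
    𝓢(EuclideanSpace ℝ (Fin n), ℂ) →L[ℂ] 𝓢(EuclideanSpace ℝ (Fin n), ℂ) :=
  zSchwartz ħ k - (z k : ℂ) • ContinuousLinearMap.id ℂ _

variable (ħ : ℝ)

lemma zSchwartz_inl (j : Fin n) (f : 𝓢(EuclideanSpace ℝ (Fin n), ℂ)) :
    zSchwartz ħ (.inl j) f = (-Complex.I * ħ) • ∂_{EuclideanSpace.single j (1 : ℝ)} f := rfl

lemma zSchwartz_inr_apply (j : Fin n) (f : 𝓢(EuclideanSpace ℝ (Fin n), ℂ))
    (x : EuclideanSpace ℝ (Fin n)) : zSchwartz ħ (.inr j) f x = x j * f x := by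
  rw [zSchwartz, SchwartzMap.smulLeftCLM_apply_apply (hasTemperateGrowth_coord_ofReal j),
    smul_eq_mul]

lemma dzSchwartz_apply (z : PhaseVec n) (k : Fin n ⊕ Fin n)
    (f : 𝓢(EuclideanSpace ℝ (Fin n), ℂ)) :
    dzSchwartz ħ z k f = zSchwartz ħ k f - (z k : ℂ) • f := rfl

lemma dzSchwartz_inr_apply (z : PhaseVec n) (j : Fin n)
    (f : 𝓢(EuclideanSpace ℝ (Fin n), ℂ)) (x : EuclideanSpace ℝ (Fin n)) :
    dzSchwartz ħ z (.inr j) f x = (x j - z (.inr j)) * f x := by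
  rw [dzSchwartz_apply, _root_.sub_apply, zSchwartz_inr_apply, _root_.smul_apply, smul_eq_mul,
    sub_mul]

lemma coe_zSchwartz (k : Fin n ⊕ Fin n) (f : 𝓢(EuclideanSpace ℝ (Fin n), ℂ)) :
    ⇑(zSchwartz ħ k f) = zOp ħ k f := by
  funext x
  rcases k with j | j
  · rw [zSchwartz_inl, _root_.smul_apply, SchwartzMap.lineDerivOp_apply_eq_fderiv]; rfl
  · exact zSchwartz_inr_apply ħ j f x

lemma coe_dzSchwartz (z : PhaseVec n) (k : Fin n ⊕ Fin n)
    (f : 𝓢(EuclideanSpace ℝ (Fin n), ℂ)) : ⇑(dzSchwartz ħ z k f) = dzOp ħ z k f := by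
  funext x
  rw [dzSchwartz_apply, _root_.sub_apply, coe_zSchwartz]
  rfl

/-- `T` maps states centred at `z` to states centred at `z'` and transforms the canonical
operators linearly: `(ẑ - z') T = T M (ẑ - z)`. -/
def Intertwines (M : PhaseMat n) (z z' : PhaseVec n)
    (T : 𝓢(EuclideanSpace ℝ (Fin n), ℂ) →L[ℂ] 𝓢(EuclideanSpace ℝ (Fin n), ℂ)) : Prop :=
  ∀ k f, dzSchwartz ħ z' k (T f) = T (∑ l, (M k l : ℂ) • dzSchwartz ħ z l f)

variable {ħ} {M M' : PhaseMat n} {z z' z'' : PhaseVec n}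
  {T T' : 𝓢(EuclideanSpace ℝ (Fin n), ℂ) →L[ℂ] 𝓢(EuclideanSpace ℝ (Fin n), ℂ)}

lemma Intertwines.comp (hT' : Intertwines ħ M' z' z'' T') (hT : Intertwines ħ M z z' T) :
    Intertwines ħ (M' * M) z z'' (T' ∘L T) := by
  intro k f
  have hmul : ∑ l, (M' k l : ℂ) • ∑ m, (M l m : ℂ) • dzSchwartz ħ z m f =
      ∑ m, ((M' * M) k m : ℂ) • dzSchwartz ħ z m f := by
    simp only [Finset.smul_sum, smul_smul, Matrix.mul_apply, Complex.ofReal_sum,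
      Complex.ofReal_mul, Finset.sum_smul]
    exact Finset.sum_comm
  rw [ContinuousLinearMap.comp_apply, hT' k, ContinuousLinearMap.comp_apply, ← hmul, map_sum T]
  simp only [hT _ f, map_smul T]

lemma Intertwines.translate (hT : Intertwines ħ M z z' T) (w : PhaseVec n) :
    Intertwines ħ M (z + w) (z' + M *ᵥ w) T := by
  have hshift (z w : PhaseVec n) (k : Fin n ⊕ Fin n) (f : 𝓢(EuclideanSpace ℝ (Fin n), ℂ)) :
      dzSchwartz ħ (z + w) k f = dzSchwartz ħ z k f - (w k : ℂ) • f := by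
    rw [dzSchwartz_apply, dzSchwartz_apply, Pi.add_apply, Complex.ofReal_add, add_smul,
      ← sub_sub]
  intro k f
  simp only [hshift, hT k f, smul_sub, Finset.sum_sub_distrib, map_sub, map_sum, map_smul,
    Matrix.mulVec, dotProduct, Complex.ofReal_sum, Complex.ofReal_mul, Finset.sum_smul, smul_smul]

/-! ### Multiplication by a factor with a quadratic phase -/

/-- The quadratic polynomial `k + ⟨v, x - X⟩ + ½⟨x - X, Q (x - X)⟩`. -/
noncomputable def quadPoly (k : ℝ) (v : Fin n → ℝ) (Q : Matrix (Fin n) (Fin n) ℝ) (X : Fin n → ℝ)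
    (x : EuclideanSpace ℝ (Fin n)) : ℝ :=
  k + v ⬝ᵥ (x.ofLp - X) + 1 / 2 * ((x.ofLp - X) ⬝ᵥ (Q *ᵥ (x.ofLp - X)))

variable (k : ℝ) (v : Fin n → ℝ) {Q : Matrix (Fin n) (Fin n) ℝ} (P X : Fin n → ℝ)

variable (Q) in
lemma hasTemperateGrowth_quadPoly : (quadPoly k v Q X).HasTemperateGrowth := by
  have hsub (j : Fin n) :
      Function.HasTemperateGrowth fun x : EuclideanSpace ℝ (Fin n) => (x.ofLp - X) j :=
    (hasTemperateGrowth_coord j).sub (.const _)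
  have hmulVec (j : Fin n) :
      Function.HasTemperateGrowth fun x : EuclideanSpace ℝ (Fin n) => (Q *ᵥ (x.ofLp - X)) j :=
    (Function.HasTemperateGrowth.sum fun i _ =>
        (Function.HasTemperateGrowth.const (Q j i)).mul (hsub i) :
      Function.HasTemperateGrowth fun x : EuclideanSpace ℝ (Fin n) =>
        ∑ i, Q j i * (x.ofLp - X) i)
  have hlin : Function.HasTemperateGrowth fun x : EuclideanSpace ℝ (Fin n) =>
      v ⬝ᵥ (x.ofLp - X) :=
    .sum fun j _ => (Function.HasTemperateGrowth.const (v j)).mul (hsub j)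
  have hquad : Function.HasTemperateGrowth fun x : EuclideanSpace ℝ (Fin n) =>
      (x.ofLp - X) ⬝ᵥ (Q *ᵥ (x.ofLp - X)) :=
    .sum fun j _ => (hsub j).mul (hmulVec j)
  exact ((Function.HasTemperateGrowth.const k).add hlin).add
    ((Function.HasTemperateGrowth.const (1 / 2 : ℝ)).mul hquad)

lemma hasLineDerivAt_quadPoly (hQ : Q.IsSymm) (x m : EuclideanSpace ℝ (Fin n)) :
    HasLineDerivAt ℝ (quadPoly k v Q X) ((v + Q *ᵥ (x.ofLp - X)) ⬝ᵥ m.ofLp) x m := by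
  set u : ℝ → Fin n → ℝ := fun τ => (x + τ • m).ofLp - X
  have hu0 : u 0 = x.ofLp - X := by simp [u]
  have hu (j : Fin n) : HasDerivAt (fun τ => u τ j) (m j) 0 := by
    simpa [u] using
      (((hasDerivAt_id (0 : ℝ)).mul_const (m j)).const_add (x j)).sub_const (X j)
  have hlin : HasDerivAt (fun τ => v ⬝ᵥ u τ) (v ⬝ᵥ m.ofLp) 0 :=
    HasDerivAt.fun_sum fun j _ => (hu j).const_mul (v j)
  have hmulVec (j : Fin n) : HasDerivAt (fun τ => (Q *ᵥ u τ) j) ((Q *ᵥ m.ofLp) j) 0 :=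
    (HasDerivAt.fun_sum fun i _ => (hu i).const_mul (Q j i) :
      HasDerivAt (fun τ => ∑ i, Q j i * u τ i) (∑ i, Q j i * m i) 0)
  have hquad : HasDerivAt (fun τ => u τ ⬝ᵥ (Q *ᵥ u τ))
      (∑ j, (m j * (Q *ᵥ u 0) j + u 0 j * (Q *ᵥ m.ofLp) j)) 0 :=
    HasDerivAt.fun_sum fun j _ => (hu j).mul (hmulVec j)
  have hsymm : u 0 ⬝ᵥ (Q *ᵥ m.ofLp) = m.ofLp ⬝ᵥ (Q *ᵥ u 0) := by
    rw [dotProduct_comm, ← Matrix.vecMul_transpose, hQ.eq, ← Matrix.dotProduct_mulVec]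
  refine ((hlin.const_add k).add (hquad.const_mul (1 / 2))).congr_deriv ?_
  rw [Finset.sum_add_distrib]
  change v ⬝ᵥ m.ofLp + 1 / 2 * (m.ofLp ⬝ᵥ (Q *ᵥ u 0) + u 0 ⬝ᵥ (Q *ᵥ m.ofLp)) = _
  rw [hsymm, hu0, add_dotProduct, dotProduct_comm (Q *ᵥ _)]
  ring

lemma intertwines_phaseMul_quadPoly (hħ : ħ ≠ 0) (hQ : Q.IsSymm) :
    Intertwines ħ (.fromBlocks 1 Q 0 1) (Sum.elim P X) (Sum.elim (P + v) X)
      (phaseMul ħ (quadPoly k v Q X)) := by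
  have hq := hasTemperateGrowth_quadPoly k v Q X
  have hħ' : (ħ : ℂ) ≠ 0 := Complex.ofReal_ne_zero.2 hħ
  have hone (j : Fin n) (a : Fin n → 𝓢(EuclideanSpace ℝ (Fin n), ℂ)) :
      ∑ l, ((1 : Matrix (Fin n) (Fin n) ℝ) j l : ℂ) • a l = a j := by
    simp [Matrix.one_apply]
  rintro (j | j) f <;>
    simp only [Fintype.sum_sum_type, Matrix.fromBlocks_apply₁₁, Matrix.fromBlocks_apply₁₂,
      Matrix.fromBlocks_apply₂₁, Matrix.fromBlocks_apply₂₂, hone] <;>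
    ext x <;> rw [phaseMul_apply ħ hq]
  · have hsum : (∑ l, (Q j l : ℂ) • dzSchwartz ħ (Sum.elim P X) (.inr l) f) x =
        ((Q *ᵥ (x.ofLp - X)) j : ℝ) * f x := by
      simp [dzSchwartz_inr_apply, Matrix.mulVec, dotProduct, Finset.sum_mul, mul_assoc]
    have hderiv := lineDerivOp_phaseMul_apply ħ hq
      (hasLineDerivAt_quadPoly k v X hQ x (EuclideanSpace.single j 1)) f
    rw [PiLp.ofLp_single, dotProduct_single_one] at hderiv
    rw [_root_.add_apply, hsum]
    simp only [dzSchwartz_apply, zSchwartz_inl, _root_.sub_apply,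
      _root_.smul_apply, smul_eq_mul, phaseMul_apply ħ hq, hderiv, Sum.elim_inl, Pi.add_apply,
      Complex.ofReal_add]
    field_simp
    linear_combination (-phaseFactor ħ (quadPoly k v Q X) x * f x *
      (v j + (Q *ᵥ (x.ofLp - X)) j)) * Complex.I_sq
  · simp [dzSchwartz_inr_apply, phaseMul_apply ħ hq, mul_left_comm]

/-! ### The Fourier transform with a dilated frequency -/

variable {R : Matrix (Fin n) (Fin n) ℝ}

lemma det_toEuclideanLin (A : Matrix (Fin n) (Fin n) ℝ) :
    LinearMap.det (Matrix.toEuclideanLin A) = A.det := by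
  rw [Matrix.toEuclideanLin_eq_toLin_orthonormal, LinearMap.det_toLin]

lemma det_toEuclideanLin_frequency :
    LinearMap.det (Matrix.toEuclideanLin (-(2 * Real.pi * ħ)⁻¹ • Rᵀ)) =
      (-(2 * Real.pi * ħ)⁻¹) ^ n * R.det := by
  rw [det_toEuclideanLin, Matrix.det_smul, Matrix.det_transpose, Fintype.card_fin]

/-- The frequency `-(2πħ)⁻¹ Rᵀ x`, for which `e^{-2πi⟨y, ·⟩}` is `e^{(i/ħ)⟨x, R y⟩}`. -/
noncomputable def frequencyEquiv (hħ : ħ ≠ 0) (hR : R.det ≠ 0) :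
    EuclideanSpace ℝ (Fin n) ≃L[ℝ] EuclideanSpace ℝ (Fin n) :=
  ((Matrix.toEuclideanLin (-(2 * Real.pi * ħ)⁻¹ • Rᵀ)).equivOfDetNeZero <| by
    rw [det_toEuclideanLin_frequency]
    exact mul_ne_zero (pow_ne_zero _ (neg_ne_zero.2 (inv_ne_zero
      (mul_ne_zero Real.two_pi_pos.ne' hħ)))) hR).toContinuousLinearEquiv

variable (hħ : ħ ≠ 0) (hR : R.det ≠ 0)

lemma det_frequencyEquiv :
    LinearMap.det (frequencyEquiv hħ hR : EuclideanSpace ℝ (Fin n) →ₗ[ℝ] _) =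
      (-(2 * Real.pi * ħ)⁻¹) ^ n * R.det :=
  det_toEuclideanLin_frequency

lemma inner_frequencyEquiv (y x : EuclideanSpace ℝ (Fin n)) :
    inner ℝ y (frequencyEquiv hħ hR x) = -(2 * Real.pi * ħ)⁻¹ * (x.ofLp ⬝ᵥ (R *ᵥ y.ofLp)) := by
  have happly : (frequencyEquiv hħ hR x).ofLp = -(2 * Real.pi * ħ)⁻¹ • (x.ofLp ᵥ* R) := by
    change (-(2 * Real.pi * ħ)⁻¹ • Rᵀ) *ᵥ x.ofLp = _
    rw [Matrix.smul_mulVec, Matrix.mulVec_transpose]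
  rw [EuclideanSpace.inner_eq_star_dotProduct, star_trivial, happly, smul_dotProduct,
    Matrix.dotProduct_mulVec, smul_eq_mul]

variable (c : ℂ)

lemma zSchwartz_inl_dilatedFourier (j : Fin n) (f : 𝓢(EuclideanSpace ℝ (Fin n), ℂ)) :
    zSchwartz ħ (.inl j) (dilatedFourier c (frequencyEquiv hħ hR) f) =
      dilatedFourier c (frequencyEquiv hħ hR) (∑ i, (R j i : ℂ) • zSchwartz ħ (.inr i) f) := by
  have hħ' : (ħ : ℂ) ≠ 0 := Complex.ofReal_ne_zero.2 hħ
  rw [zSchwartz_inl, lineDerivOp_dilatedFourier, ← map_smul]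
  congr 1
  ext x
  have hinner : (inner ℝ · (frequencyEquiv hħ hR (EuclideanSpace.single j 1)) :
      EuclideanSpace ℝ (Fin n) → ℝ).HasTemperateGrowth := by fun_prop
  have hsum : (∑ i, (R j i : ℂ) • zSchwartz ħ (.inr i) f) x = ((R *ᵥ x.ofLp) j : ℝ) * f x := by
    simp [zSchwartz_inr_apply, Matrix.mulVec, dotProduct, Finset.sum_mul, mul_assoc]
  rw [hsum, _root_.smul_apply, _root_.smul_apply, SchwartzMap.smulLeftCLM_apply_apply hinner,
    inner_frequencyEquiv, PiLp.ofLp_single, single_one_dotProduct, smul_eq_mul, smul_eq_mul,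
    Complex.real_smul]
  push_cast
  field_simp
  linear_combination (-((R *ᵥ x.ofLp) j : ℂ) * f x) * Complex.I_sq

lemma dilatedFourier_zSchwartz_inl_apply (l : Fin n) (f : 𝓢(EuclideanSpace ℝ (Fin n), ℂ))
    (x : EuclideanSpace ℝ (Fin n)) :
    dilatedFourier c (frequencyEquiv hħ hR) (zSchwartz ħ (.inl l) f) x =
      -((x.ofLp ᵥ* R) l : ℝ) * dilatedFourier c (frequencyEquiv hħ hR) f x := by
  have hħ' : (ħ : ℂ) ≠ 0 := Complex.ofReal_ne_zero.2 hħ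
  rw [zSchwartz_inl, map_smul, _root_.smul_apply, ← inner_mul_dilatedFourier_apply,
    real_inner_comm, inner_frequencyEquiv, PiLp.ofLp_single, Matrix.dotProduct_mulVec,
    dotProduct_single_one, smul_eq_mul]
  push_cast
  field_simp
  linear_combination (((x.ofLp ᵥ* R) l : ℂ) * dilatedFourier c (frequencyEquiv hħ hR) f x) *
    Complex.I_sq

lemma intertwines_dilatedFourier :
    Intertwines ħ (.fromBlocks 0 R (-(R⁻¹)ᵀ) 0) (Sum.elim P X)
      (Sum.elim (R *ᵥ X) (-(P ᵥ* R⁻¹))) (dilatedFourier c (frequencyEquiv hħ hR)) := by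
  suffices h : Intertwines ħ (.fromBlocks 0 R (-(R⁻¹)ᵀ) 0) 0 0
      (dilatedFourier c (frequencyEquiv hħ hR)) by
    simpa [Matrix.fromBlocks_mulVec, Matrix.neg_mulVec, Matrix.mulVec_transpose] using
      h.translate (Sum.elim P X)
  have hdz (k : Fin n ⊕ Fin n) (f : 𝓢(EuclideanSpace ℝ (Fin n), ℂ)) :
      dzSchwartz ħ 0 k f = zSchwartz ħ k f := by simp [dzSchwartz_apply]
  rintro (j | j) f <;>
    simp only [hdz, Fintype.sum_sum_type, Matrix.fromBlocks_apply₁₁, Matrix.fromBlocks_apply₁₂,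
      Matrix.fromBlocks_apply₂₁, Matrix.fromBlocks_apply₂₂, Matrix.zero_apply, Complex.ofReal_zero,
      zero_smul, Finset.sum_const_zero, zero_add, add_zero]
  · exact zSchwartz_inl_dilatedFourier hħ hR c j f
  · ext x
    have hinv : ∑ l, (x.ofLp ᵥ* R) l * R⁻¹ l j = x j :=
      congrFun (show (x.ofLp ᵥ* R) ᵥ* R⁻¹ = x.ofLp by
        rw [Matrix.vecMul_vecMul, Matrix.mul_nonsing_inv R hR.isUnit, Matrix.vecMul_one]) j
    rw [zSchwartz_inr_apply, ← hinv, map_sum, _root_.sum_apply, Complex.ofReal_sum,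
      Finset.sum_mul]
    refine Finset.sum_congr rfl fun l _ => ?_
    rw [map_smul, _root_.smul_apply, dilatedFourier_zSchwartz_inl_apply, Matrix.neg_apply,
      Matrix.transpose_apply, smul_eq_mul]
    push_cast
    ring

end CanonicalOperators

section Moments

variable {n : ℕ}

open scoped SchwartzMap

/-! ### Moments of Schwartz functions -/

lemma normSq_eq (f : 𝓢(EuclideanSpace ℝ (Fin n), ℂ)) : (normSq f : ℂ) = pairing f f := by
  rw [pairing_apply, normSq, ← integral_complex_ofReal]
  congr 1 with x
  rw [Complex.ofReal_pow, Complex.star_def, Complex.conj_mul']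

lemma eq_zero_of_normSq_eq_zero {f : 𝓢(EuclideanSpace ℝ (Fin n), ℂ)} (h : normSq f = 0) :
    f = 0 :=
  eq_zero_of_pairing_self_eq_zero (by rw [← normSq_eq, h, Complex.ofReal_zero])

lemma mean_eq {A : (EuclideanSpace ℝ (Fin n) → ℂ) → EuclideanSpace ℝ (Fin n) → ℂ}
    {f h : 𝓢(EuclideanSpace ℝ (Fin n), ℂ)} (hA : A f = h) :
    mean A f = (pairing f h).re / normSq f := by
  rw [mean, hA, pairing_apply]

lemma re_pairing_dzSchwartz (ħ : ℝ) {f : 𝓢(EuclideanSpace ℝ (Fin n), ℂ)} (hf : normSq f ≠ 0)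
    (z : PhaseVec n) (k : Fin n ⊕ Fin n) :
    (pairing f (dzSchwartz ħ z k f)).re = normSq f * (zMean ħ f k - z k) := by
  rw [zMean, mean_eq (coe_zSchwartz ħ k f).symm, dzSchwartz_apply, map_sub, map_smul, ← normSq_eq,
    Complex.sub_re, smul_eq_mul, ← Complex.ofReal_mul, Complex.ofReal_re]
  field_simp

/-- The matrix `Re ⟨f, Δẑ_j Δẑ_k f⟩` of unnormalised second moments, not symmetrised, with
`Δẑ = ẑ - z` for an arbitrary `z`. -/
noncomputable def secondMoments (ħ : ℝ) (z : PhaseVec n) (f : 𝓢(EuclideanSpace ℝ (Fin n), ℂ)) :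
    PhaseMat n :=
  Matrix.of fun j k => (pairing f (dzSchwartz ħ z j (dzSchwartz ħ z k f))).re

lemma covMean_eq (ħ : ℝ) (f : 𝓢(EuclideanSpace ℝ (Fin n), ℂ)) :
    covMean ħ f = (2 * normSq f)⁻¹ •
      (secondMoments ħ (zMean ħ f) f + (secondMoments ħ (zMean ħ f) f)ᵀ) := by
  ext j k
  set Δ := dzSchwartz ħ (zMean ħ f)
  have hsum : (fun x => dzOp ħ (zMean ħ f) j (dzOp ħ (zMean ħ f) k f) x +
      dzOp ħ (zMean ħ f) k (dzOp ħ (zMean ħ f) j f) x) = ⇑(Δ j (Δ k f) + Δ k (Δ j f)) := by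
    funext x
    simp only [Δ, _root_.add_apply, coe_dzSchwartz]
  rw [covMean, Matrix.of_apply, mean_eq (h := Δ j (Δ k f) + Δ k (Δ j f)) hsum, map_add,
    Complex.add_re]
  simp only [Matrix.smul_apply, Matrix.add_apply, Matrix.transpose_apply, secondMoments,
    Matrix.of_apply, smul_eq_mul, mul_inv, Δ]
  ring

variable {ħ : ℝ} {M : PhaseMat n} {z z' : PhaseVec n}
  {T : 𝓢(EuclideanSpace ℝ (Fin n), ℂ) →L[ℂ] 𝓢(EuclideanSpace ℝ (Fin n), ℂ)}
  {f : 𝓢(EuclideanSpace ℝ (Fin n), ℂ)}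

lemma PreservesPairing.normSq_apply (hT : PreservesPairing T)
    (f : 𝓢(EuclideanSpace ℝ (Fin n), ℂ)) : normSq (T f) = normSq f := by
  rw [← Complex.ofReal_inj, normSq_eq, normSq_eq, hT]

lemma Intertwines.zMean_apply (hT : Intertwines ħ M (zMean ħ f) z' T) (hiso : PreservesPairing T)
    (hf : normSq f ≠ 0) : zMean ħ (T f) = z' := by
  funext k
  have hmean : (pairing (T f) (dzSchwartz ħ z' k (T f))).re = 0 := by
    rw [hT, hiso, map_sum, Complex.re_sum]
    refine Finset.sum_eq_zero fun l _ => ?_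
    rw [map_smul, smul_eq_mul, Complex.re_ofReal_mul, re_pairing_dzSchwartz ħ hf, sub_self,
      mul_zero, mul_zero]
  rw [re_pairing_dzSchwartz ħ (by rwa [hiso.normSq_apply]), hiso.normSq_apply] at hmean
  exact sub_eq_zero.1 ((mul_eq_zero.1 hmean).resolve_left hf)

lemma Intertwines.secondMoments_apply (hT : Intertwines ħ M z z' T) (hiso : PreservesPairing T)
    (f : 𝓢(EuclideanSpace ℝ (Fin n), ℂ)) :
    secondMoments ħ z' (T f) = M * secondMoments ħ z f * Mᵀ := by
  ext j k
  simp only [secondMoments, Matrix.of_apply, Matrix.mul_apply, Matrix.transpose_apply, hT _ _,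
    hiso _ _, map_sum, map_smul, smul_eq_mul, Complex.re_sum, Complex.re_ofReal_mul,
    Finset.sum_mul, Finset.smul_sum]
  exact Finset.sum_congr rfl fun l _ => Finset.sum_congr rfl fun m _ => by ring

lemma Intertwines.moments_apply (hT : Intertwines ħ M (zMean ħ f) z' T)
    (hiso : PreservesPairing T) (hf : normSq f ≠ 0) :
    moments ħ (T f) = (z', M * covMean ħ f * Mᵀ) := by
  have hz : zMean ħ (T f) = z' := hT.zMean_apply hiso hf
  rw [moments, covMean_eq, covMean_eq, hz, hiso.normSq_apply, hT.secondMoments_apply hiso]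
  simp only [Matrix.transpose_mul, Matrix.transpose_transpose, Matrix.mul_smul, Matrix.smul_mul,
    Matrix.mul_add, Matrix.add_mul, Matrix.mul_assoc]

end Moments

/-! ### The Green operator -/

section FreeFactorization

variable {n : ℕ} {D : Coeffs n} {κt t s : ℝ} (hdet : (lam3 D κt t s).det ≠ 0)
include hdet

lemma lam1_mul_lam3_inv_isSymm : (lam1 D κt t s * (lam3 D κt t s)⁻¹).IsSymm := by
  have hu : IsUnit (lam3 D κt t s).det := isUnit_iff_ne_zero.2 hdet
  have hu' : IsUnit ((lam3 D κt t s)ᵀ).det := by rwa [Matrix.det_transpose]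
  rw [Matrix.IsSymm, Matrix.transpose_mul, Matrix.transpose_nonsing_inv]
  calc ((lam3 D κt t s)ᵀ)⁻¹ * (lam1 D κt t s)ᵀ
      = ((lam3 D κt t s)ᵀ)⁻¹ * ((lam1 D κt t s)ᵀ * lam3 D κt t s) * (lam3 D κt t s)⁻¹ := by
        rw [Matrix.mul_assoc, Matrix.mul_nonsing_inv_cancel_right _ _ hu]
    _ = _ := by
        rw [← lam3_transpose_mul_lam1, Matrix.nonsing_inv_mul_cancel_left _ _ hu']

lemma lam3_inv_mul_lam4_isSymm : ((lam3 D κt t s)⁻¹ * lam4 D κt t s).IsSymm := by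
  have hu : IsUnit (lam3 D κt t s).det := isUnit_iff_ne_zero.2 hdet
  have hu' : IsUnit ((lam3 D κt t s)ᵀ).det := by rwa [Matrix.det_transpose]
  rw [Matrix.IsSymm, Matrix.transpose_mul, Matrix.transpose_nonsing_inv]
  calc (lam4 D κt t s)ᵀ * ((lam3 D κt t s)ᵀ)⁻¹
      = (lam3 D κt t s)⁻¹ * (lam3 D κt t s * (lam4 D κt t s)ᵀ) * ((lam3 D κt t s)ᵀ)⁻¹ := by
        rw [Matrix.nonsing_inv_mul_cancel_left _ _ hu]
    _ = _ := by
        rw [← lam4_mul_lam3_transpose, Matrix.mul_assoc,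
          Matrix.mul_nonsing_inv_cancel_right _ _ hu']

lemma matricant_eq_mul_fromBlocks :
    matricant D κt t s = fromBlocks 1 (-((lam3 D κt t s)⁻¹ * lam4 D κt t s)) 0 1 *
      (fromBlocks 0 (lam3 D κt t s)⁻¹ (-(lam3 D κt t s)ᵀ) 0 *
        fromBlocks 1 (-(lam1 D κt t s * (lam3 D κt t s)⁻¹)) 0 1) := by
  have hu : IsUnit (lam3 D κt t s).det := isUnit_iff_ne_zero.2 hdet
  have h₁₁ : (lam3 D κt t s)⁻¹ * lam4 D κt t s * (lam3 D κt t s)ᵀ = (lam4 D κt t s)ᵀ := by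
    rw [Matrix.mul_assoc, lam4_mul_lam3_transpose, Matrix.nonsing_inv_mul_cancel_left _ _ hu]
  have h₂₂ : (lam3 D κt t s)ᵀ * (lam1 D κt t s * (lam3 D κt t s)⁻¹) = (lam1 D κt t s)ᵀ := by
    rw [← Matrix.mul_assoc, lam3_transpose_mul_lam1, Matrix.mul_nonsing_inv_cancel_right _ _ hu]
  have h₁₂ : (lam3 D κt t s)⁻¹ * lam4 D κt t s * (lam1 D κt t s)ᵀ =
      (lam3 D κt t s)⁻¹ + (lam2 D κt t s)ᵀ := by
    rw [Matrix.mul_assoc, lam4_mul_lam1_transpose, Matrix.mul_add, Matrix.mul_one,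
      Matrix.nonsing_inv_mul_cancel_left _ _ hu]
  rw [matricant_eq_fromBlocks, fromBlocks_multiply, fromBlocks_multiply]
  simp [h₁₁, h₂₂, h₁₂]

lemma det_lam3_inv_ne_zero : (lam3 D κt t s)⁻¹.det ≠ 0 := by
  rw [Matrix.det_nonsing_inv, Ring.inverse_eq_inv']
  exact inv_ne_zero hdet

lemma lam3_inv_swap : (lam3 D κt s t)⁻¹ = -((lam3 D κt t s)⁻¹)ᵀ := by
  rw [lam3_swap]
  refine Matrix.inv_eq_right_inv ?_
  rw [_root_.neg_mul_neg, ← Matrix.transpose_mul,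
    Matrix.nonsing_inv_mul _ (isUnit_iff_ne_zero.2 hdet), Matrix.transpose_one]

end FreeFactorization

section Phase

variable {n : ℕ} (D : Coeffs n) (κt : ℝ) (g : ℝ → PhaseVec n × PhaseMat n) (t s : ℝ)

/-- The part of `greenPhase` that depends on `x` alone, when the mixed term is `⟨x, λ₃⁻¹ y⟩`. -/
noncomputable def outerPhase : EuclideanSpace ℝ (Fin n) → ℝ :=
  quadPoly (action D κt g t - action D κt g s)
    ((g t).1 ∘ Sum.inl - (lam3 D κt t s)⁻¹ *ᵥ ((g s).1 ∘ Sum.inr))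
    (-((lam3 D κt t s)⁻¹ * lam4 D κt t s)) ((g t).1 ∘ Sum.inr)

/-- The part of `greenPhase` that depends on `y` alone, when the mixed term is `⟨x, λ₃⁻¹ y⟩`. -/
noncomputable def innerPhase : EuclideanSpace ℝ (Fin n) → ℝ :=
  quadPoly (-(((g t).1 ∘ Sum.inr) ⬝ᵥ ((lam3 D κt t s)⁻¹ *ᵥ ((g s).1 ∘ Sum.inr))))
    (-((g s).1 ∘ Sum.inl) - ((g t).1 ∘ Sum.inr) ᵥ* (lam3 D κt t s)⁻¹)
    (-(lam1 D κt t s * (lam3 D κt t s)⁻¹)) ((g s).1 ∘ Sum.inr)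

lemma hasTemperateGrowth_outerPhase : (outerPhase D κt g t s).HasTemperateGrowth :=
  hasTemperateGrowth_quadPoly _ _ _ _

lemma hasTemperateGrowth_innerPhase : (innerPhase D κt g t s).HasTemperateGrowth :=
  hasTemperateGrowth_quadPoly _ _ _ _

lemma greenPhase_eq (x y : EuclideanSpace ℝ (Fin n)) :
    greenPhase D κt g t s x y = outerPhase D κt g t s x + innerPhase D κt g t s y +
      x.ofLp ⬝ᵥ ((lam3 D κt t s)⁻¹ *ᵥ y.ofLp) := by
  have hx : (fun j => x j - (g t).1 (.inr j)) = x.ofLp - (g t).1 ∘ Sum.inr := rfl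
  have hy : (fun j => y j - (g s).1 (.inr j)) = y.ofLp - (g s).1 ∘ Sum.inr := rfl
  have hP (τ : ℝ) : (fun j => (g τ).1 (.inl j)) = (g τ).1 ∘ Sum.inl := rfl
  simp only [greenPhase, outerPhase, innerPhase, quadPoly, hx, hy, hP, Matrix.neg_mulVec,
    dotProduct_neg, Matrix.mulVec_sub, dotProduct_sub, sub_dotProduct, neg_dotProduct,
    ← Matrix.dotProduct_mulVec, dotProduct_comm (_ *ᵥ _)]
  ring

lemma greenPhase_swap (hdet : (lam3 D κt t s).det ≠ 0) (x y : EuclideanSpace ℝ (Fin n)) :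
    greenPhase D κt g s t x y = -greenPhase D κt g t s y x := by
  have houter : lam1 D κt s t * (lam3 D κt s t)⁻¹ = -((lam3 D κt t s)⁻¹ * lam4 D κt t s) := by
    rw [lam3_inv_swap hdet, lam1_swap, Matrix.mul_neg, ← Matrix.transpose_mul,
      (lam3_inv_mul_lam4_isSymm hdet).eq]
  have hinner : (lam3 D κt s t)⁻¹ * lam4 D κt s t = -(lam1 D κt t s * (lam3 D κt t s)⁻¹) := by
    rw [lam3_inv_swap hdet, lam4_swap, Matrix.neg_mul, ← Matrix.transpose_mul,
      (lam1_mul_lam3_inv_isSymm hdet).eq]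
  simp only [greenPhase]
  rw [houter, hinner, lam3_inv_swap hdet]
  simp only [Matrix.neg_mulVec, dotProduct_neg, Matrix.mulVec_transpose]
  rw [dotProduct_comm (fun j => x j - (g s).1 (.inr j)) (_ ᵥ* _), ← Matrix.dotProduct_mulVec]
  ring

end Phase

section GreenOperator

open scoped SchwartzMap

variable {n : ℕ} {D : Coeffs n} {ħ κt t s : ℝ} (g : ℝ → PhaseVec n × PhaseMat n) (hħ : 0 < ħ)
  (hdet : (lam3 D κt t s).det ≠ 0)

include hħ hdet in
lemma green_swap (x y : EuclideanSpace ℝ (Fin n)) :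
    green D ħ κt g s t x y = star (green D ħ κt g t s y x) := by
  rw [green, green, sqrtDet_swap D hħ hdet, greenPhase_swap D κt g t s hdet x y, star_mul',
    star_div₀, star_one]
  congr 1
  rw [Complex.star_def, ← Complex.exp_conj]
  congr 1
  simp [neg_div]

/-- The integral operator with the kernel `green D ħ κt g t s` on Schwartz functions. -/
noncomputable def greenOp :
    𝓢(EuclideanSpace ℝ (Fin n), ℂ) →L[ℂ] 𝓢(EuclideanSpace ℝ (Fin n), ℂ) :=
  phaseMul ħ (outerPhase D κt g t s) ∘L
    dilatedFourier (1 / sqrtDet D ħ κt t s)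
      (frequencyEquiv hħ.ne' (det_lam3_inv_ne_zero hdet)) ∘L
    phaseMul ħ (innerPhase D κt g t s)

lemma green_eq (x y : EuclideanSpace ℝ (Fin n)) :
    green D ħ κt g t s x y = phaseFactor ħ (outerPhase D κt g t s) x *
      (1 / sqrtDet D ħ κt t s * Complex.exp ((-2 * Real.pi * inner ℝ y
        (frequencyEquiv hħ.ne' (det_lam3_inv_ne_zero hdet) x) : ℝ) * Complex.I)) *
      phaseFactor ħ (innerPhase D κt g t s) y := by
  have hħ' : (ħ : ℂ) ≠ 0 := Complex.ofReal_ne_zero.2 hħ.ne'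
  have hphase : Complex.I / ħ * greenPhase D κt g t s x y =
      Complex.I / ħ * outerPhase D κt g t s x +
      ((-2 * Real.pi * inner ℝ y (frequencyEquiv hħ.ne' (det_lam3_inv_ne_zero hdet) x) : ℝ) *
        Complex.I) + Complex.I / ħ * innerPhase D κt g t s y := by
    rw [greenPhase_eq, inner_frequencyEquiv]
    push_cast
    field_simp
    ring
  rw [green, hphase, Complex.exp_add, Complex.exp_add, phaseFactor, phaseFactor]
  ring

lemma greenOp_apply (f : 𝓢(EuclideanSpace ℝ (Fin n), ℂ)) (x : EuclideanSpace ℝ (Fin n)) :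
    greenOp g hħ hdet f x = ∫ y, green D ħ κt g t s x y * f y := by
  rw [greenOp, ContinuousLinearMap.comp_apply, ContinuousLinearMap.comp_apply,
    phaseMul_apply ħ (hasTemperateGrowth_outerPhase D κt g t s), dilatedFourier_eq_integral,
    ← integral_const_mul]
  congr 1 with y
  rw [phaseMul_apply ħ (hasTemperateGrowth_innerPhase D κt g t s), green_eq g hħ hdet]
  ring

lemma norm_sq_inv_sqrtDet : ‖1 / sqrtDet D ħ κt t s‖ ^ 2 =
    |LinearMap.det (frequencyEquiv hħ.ne' (det_lam3_inv_ne_zero hdet) :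
      EuclideanSpace ℝ (Fin n) →ₗ[ℝ] _)| := by
  have hpos : (0 : ℝ) < 2 * Real.pi * ħ := by positivity
  rw [det_frequencyEquiv, norm_div, div_pow, norm_sqrtDet_sq D hħ hdet, abs_mul, abs_pow, abs_neg,
    abs_inv, abs_of_pos hpos, Matrix.det_nonsing_inv, Ring.inverse_eq_inv', abs_inv, norm_one,
    one_pow, one_div, mul_inv, inv_pow]

lemma preservesPairing_greenOp : PreservesPairing (greenOp g hħ hdet) :=
  (preservesPairing_phaseMul ħ (hasTemperateGrowth_outerPhase D κt g t s)).comp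
    ((preservesPairing_dilatedFourier (norm_sq_inv_sqrtDet hħ hdet)).comp
      (preservesPairing_phaseMul ħ (hasTemperateGrowth_innerPhase D κt g t s)))

lemma integral_green_swap_mul_greenOp (f : 𝓢(EuclideanSpace ℝ (Fin n), ℂ))
    (x : EuclideanSpace ℝ (Fin n)) :
    ∫ y, green D ħ κt g s t x y * greenOp g hħ hdet f y = f x := by
  have hinner := hasTemperateGrowth_innerPhase D κt g t s
  set L := frequencyEquiv hħ.ne' (det_lam3_inv_ne_zero hdet) with hL
  set c := 1 / sqrtDet D ħ κt t s with hc
  calc ∫ y, green D ħ κt g s t x y * greenOp g hħ hdet f y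
      = ∫ y, star (phaseFactor ħ (innerPhase D κt g t s) x) *
          (star (c * Complex.exp ((-2 * Real.pi * inner ℝ x (L y) : ℝ) * Complex.I)) *
            dilatedFourier c L (phaseMul ħ (innerPhase D κt g t s) f) y) := by
        congr 1 with y
        rw [green_swap g hħ hdet, green_eq g hħ hdet, star_mul', star_mul' (phaseFactor _ _ _),
          greenOp, ContinuousLinearMap.comp_apply, ContinuousLinearMap.comp_apply,
          phaseMul_apply ħ (hasTemperateGrowth_outerPhase D κt g t s), ← hL, ← hc]
        linear_combination
          (star (c * Complex.exp ((-2 * Real.pi * inner ℝ x (L y) : ℝ) * Complex.I)) *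
            star (phaseFactor ħ (innerPhase D κt g t s) x) *
            dilatedFourier c L (phaseMul ħ (innerPhase D κt g t s) f) y) *
          star_phaseFactor_mul_self ħ (outerPhase D κt g t s) y
    _ = star (phaseFactor ħ (innerPhase D κt g t s) x) *
          (phaseFactor ħ (innerPhase D κt g t s) x * f x) := by
        rw [integral_const_mul,
          integral_adjoint_kernel_mul_dilatedFourier (norm_sq_inv_sqrtDet hħ hdet),
          phaseMul_apply ħ hinner]
    _ = f x := by rw [← mul_assoc, star_phaseFactor_mul_self, one_mul]

lemma intertwines_greenOp :
    Intertwines ħ (matricant D κt t s) (g s).1 (g t).1 (greenOp g hħ hdet) := by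
  have hu : IsUnit (lam3 D κt t s).det := isUnit_iff_ne_zero.2 hdet
  have hinner : Intertwines ħ (.fromBlocks 1 (-(lam1 D κt t s * (lam3 D κt t s)⁻¹)) 0 1) (g s).1
      (Sum.elim (-(((g t).1 ∘ Sum.inr) ᵥ* (lam3 D κt t s)⁻¹)) ((g s).1 ∘ Sum.inr))
      (phaseMul ħ (innerPhase D κt g t s)) := by
    have h := intertwines_phaseMul_quadPoly
      (-(((g t).1 ∘ Sum.inr) ⬝ᵥ ((lam3 D κt t s)⁻¹ *ᵥ ((g s).1 ∘ Sum.inr))))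
      (-((g s).1 ∘ Sum.inl) - ((g t).1 ∘ Sum.inr) ᵥ* (lam3 D κt t s)⁻¹)
      ((g s).1 ∘ Sum.inl) ((g s).1 ∘ Sum.inr) hħ.ne' (lam1_mul_lam3_inv_isSymm hdet).neg
    rwa [Sum.elim_comp_inl_inr, ← add_sub_assoc, add_neg_cancel, zero_sub] at h
  have hfourier : Intertwines ħ (.fromBlocks 0 (lam3 D κt t s)⁻¹ (-(lam3 D κt t s)ᵀ) 0)
      (Sum.elim (-(((g t).1 ∘ Sum.inr) ᵥ* (lam3 D κt t s)⁻¹)) ((g s).1 ∘ Sum.inr))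
      (Sum.elim ((lam3 D κt t s)⁻¹ *ᵥ ((g s).1 ∘ Sum.inr)) ((g t).1 ∘ Sum.inr))
      (dilatedFourier (1 / sqrtDet D ħ κt t s)
        (frequencyEquiv hħ.ne' (det_lam3_inv_ne_zero hdet))) := by
    have h := intertwines_dilatedFourier (-(((g t).1 ∘ Sum.inr) ᵥ* (lam3 D κt t s)⁻¹))
      ((g s).1 ∘ Sum.inr) hħ.ne' (det_lam3_inv_ne_zero hdet) (1 / sqrtDet D ħ κt t s)
    rwa [Matrix.nonsing_inv_nonsing_inv _ hu, Matrix.neg_vecMul, neg_neg, Matrix.vecMul_vecMul,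
      Matrix.nonsing_inv_mul _ hu, Matrix.vecMul_one] at h
  have houter : Intertwines ħ (.fromBlocks 1 (-((lam3 D κt t s)⁻¹ * lam4 D κt t s)) 0 1)
      (Sum.elim ((lam3 D κt t s)⁻¹ *ᵥ ((g s).1 ∘ Sum.inr)) ((g t).1 ∘ Sum.inr)) (g t).1
      (phaseMul ħ (outerPhase D κt g t s)) := by
    have h := intertwines_phaseMul_quadPoly (action D κt g t - action D κt g s)
      ((g t).1 ∘ Sum.inl - (lam3 D κt t s)⁻¹ *ᵥ ((g s).1 ∘ Sum.inr))
      ((lam3 D κt t s)⁻¹ *ᵥ ((g s).1 ∘ Sum.inr)) ((g t).1 ∘ Sum.inr) hħ.ne'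
      (lam3_inv_mul_lam4_isSymm hdet).neg
    rwa [add_sub_cancel, Sum.elim_comp_inl_inr] at h
  rw [matricant_eq_mul_fromBlocks hdet]
  exact houter.comp (hfourier.comp hinner)

end GreenOperator

section Evolution

open scoped SchwartzMap

variable {n : ℕ} {D : Coeffs n} {ħ κ t s : ℝ} (hħ : 0 < ħ)

lemma trajectory_greenOp {f : 𝓢(EuclideanSpace ℝ (Fin n), ℂ)} (hf : normSq f ≠ 0)
    (hdet : (lam3 D (κ * normSq f) t s).det ≠ 0) :
    trajectory D ħ κ t (greenOp (trajectory D ħ κ s f) hħ hdet f) = trajectory D ħ κ s f := by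
  obtain ⟨hsol, hgs⟩ : IsHESSolution D (κ * normSq f) (trajectory D ħ κ s f) ∧
      trajectory D ħ κ s f s = moments ħ f := hesSolution_spec s (moments ħ f)
  have hz : (trajectory D ħ κ s f s).1 = zMean ħ f := congrArg Prod.fst hgs
  have hΔ : (trajectory D ħ κ s f s).2 = covMean ħ f := congrArg Prod.snd hgs
  have hiso := preservesPairing_greenOp (trajectory D ħ κ s f) hħ hdet
  have htwine := intertwines_greenOp (trajectory D ħ κ s f) hħ hdet
  rw [hz] at htwine
  have hmom : moments ħ (greenOp (trajectory D ħ κ s f) hħ hdet f) = trajectory D ħ κ s f t := by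
    rw [htwine.moments_apply hiso hf, ← hΔ, ← hsol.snd_eq t s]
  rw [trajectory, hiso.normSq_apply, hmom, hesSolution_eq_of_isHESSolution hsol t]

lemma evolution_eq_greenOp (hts : t ≠ s) (f : 𝓢(EuclideanSpace ℝ (Fin n), ℂ))
    (hdet : (lam3 D (κ * normSq f) t s).det ≠ 0) :
    evolution D ħ κ t s f = greenOp (trajectory D ħ κ s f) hħ hdet f := by
  funext x
  rw [greenOp_apply, evolution, if_neg hts]

include hħ in
lemma exists_schwartz_of_mem_tcfClass {ψ : EuclideanSpace ℝ (Fin n) → ℂ}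
    (hψ : ψ ∈ tcfClass n ħ) : ∃ f : 𝓢(EuclideanSpace ℝ (Fin n), ℂ), ⇑f = ψ := by
  obtain ⟨S₀, P₀, X₀, φ₀, h⟩ := hψ
  have hc : (Real.sqrt ħ)⁻¹ ≠ 0 := inv_ne_zero (Real.sqrt_pos.2 hħ).ne'
  have hphase : Function.HasTemperateGrowth fun x : EuclideanSpace ℝ (Fin n) =>
      S₀ + inner ℝ P₀ (x - X₀) := by
    simp only [inner_sub_right]
    exact (Function.HasTemperateGrowth.const S₀).add
      ((Function.hasTemperateGrowth_inner_right P₀).sub (.const _))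
  refine ⟨phaseMul ħ (fun x => S₀ + inner ℝ P₀ (x - X₀)) (SchwartzMap.compSubConstCLM ℂ X₀
    (SchwartzMap.compCLMOfContinuousLinearEquiv ℂ
      (ContinuousLinearEquiv.smulLeft (Units.mk0 _ hc)) φ₀)), ?_⟩
  funext x
  rw [phaseMul_apply ħ hphase, h x]
  rfl

end Evolution

end NonlocalGPE

theorem mainTheorem3 {n : ℕ} (D : NonlocalGPE.Coeffs n) (ħ κ : ℝ) (hħ : 0 < ħ) (t s : ℝ)
    (ψ : EuclideanSpace ℝ (Fin n) → ℂ) (hψ : ψ ∈ NonlocalGPE.tcfClass n ħ)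
    (hdet : t ≠ s → (NonlocalGPE.lam3 D (κ * NonlocalGPE.normSq ψ) t s).det ≠ 0)
    (x : EuclideanSpace ℝ (Fin n)) :
    NonlocalGPE.evolutionInv D ħ κ t s (NonlocalGPE.evolution D ħ κ t s ψ) x = ψ x := by
  open NonlocalGPE in
  rcases eq_or_ne t s with rfl | hts
  · simp [evolutionInv, evolution]
  obtain ⟨f, rfl⟩ := exists_schwartz_of_mem_tcfClass hħ hψ
  have hdet := hdet hts
  rw [evolution_eq_greenOp hħ hts f hdet, evolutionInv, if_neg hts]
  rcases eq_or_ne (normSq f) 0 with hf | hf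
  · obtain rfl := eq_zero_of_normSq_eq_zero hf
    simp only [map_zero, _root_.zero_apply, mul_zero, integral_zero]
  · rw [trajectory_greenOp hħ hf hdet, (preservesPairing_greenOp _ hħ hdet).normSq_apply,
      integral_green_swap_mul_greenOp]
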